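/- Let $N$ be a natural number and let $Q=(q_{ij})_{i,j=1}^N$ be a real symmetric matrix with $|q_{ij}|<1$ for all $i,j$. The mixed $q$-Gaussian algebra $\Gamma_Q$ is the von Neumann algebra generated by $s_j=c_j+c_j^*$, $1\le j\le N$, where $c_j$ is the left creation operator by $e_j$ on the mixed $q$-Fock space, the completion of $\bigoplus_{n\ge 0}(\mathbb{C}^N)^{\otimes n}$ for the inner product in which tensors of different lengths are orthogonal and $$\langle e_{i_1}\otimes\cdots\otimes e_{i_n},\,e_{j_1}\otimes\cdots\otimes e_{j_n}\rangle=\sum_{\sigma\in S_n,\; j_{\sigma(a)}=i_a\,\forall a}\ \ \prod_{a<b,\;\sigma(b)<\sigma(a)}q_{i_a i_b};$$ thus $c_k^*c_j-q_{jk}c_jc_k^*=\delta_{jk}$. Its trace is $\tau(x)=\langle\Omega,x\Omega\rangle$ with $\Omega$ the vacuum, $\|x\|_2=\tau(x^*x)^{1/2}$, and $L_2(\Gamma_Q)$ is the completion of $\Gamma_Q$ for $\|\cdot\|_2$. For a word $\vec i=(i_1,\dots,i_s)$ let $w(\vec i)\in\Gamma_Q$ be the Wick word, i.e. the element with $w(\vec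 i)\Omega=e_{i_1}\otimes\cdots\otimes e_{i_s}$. Let $Q'=\begin{pmatrix}Q&Q\\Q&Q\end{pmatrix}$, a $2N\times 2N$ matrix, so that $L_2(\Gamma_Q)\subset L_2(\Gamma_{Q'})$ is the closed span of the Wick words $w(\vec i)$ with all indices in $\{1,\dots,N\}$; let $H^n$ be the span of $w(\vec i)$, $\vec i\in\{1,\dots,N\}^n$. For $t\ge0$ let $\alpha_t=\Gamma(R_t)$ be the trace preserving $*$-automorphism of $\Gamma_{Q'}$ (extended to an isometry of $L_2(\Gamma_{Q'})$) which is the second quantization of the rotation $$R_t=\begin{pmatrix}e^{-t}\,\mathrm{id}&-\sqrt{1-e^{-2t}}\,\mathrm{id}\\ \sqrt{1-e^{-2t}}\,\mathrm{id}&e^{-t}\,\mathrm{id}\end{pmatrix}$$ of $\mathbb{R}^N\oplus\mathbb{R}^N$, i.e. $\alpha_t(s_j)=\sum_m (R_t)_{mj}s_m$. Let $L_2^0(\Gamma_{Q'})$ be the space of mean zero elements, i.e. the orthogonal complement of $1$; let $F_m\subset L_2^0(\Gamma_{Q'})$ be the closed span of the Wick words $w(\vec i)$ of length at least $1$ having exactly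 $m$ indices in $\{N+1,\dots,2N\}$; let $E_m=\bigoplus_{l=0}^mF_l$, and let $P_m$ be the orthogonal projection of $L_2^0(\Gamma_{Q'})$ onto $E_m^\perp$. Then for every integer $k\ge1$ there is a constant $C_k>0$, depending only on $k$, such that for all $N$ and $Q$ as above $$\|(\alpha_{t^k}-\mathrm{id})(x)\|_2\le C_k\,\|P_{k-1}\alpha_t(x)\|_2$$ for every $x$ in the Hilbert space direct sum $\bigoplus_{n\ge k}H^n\subset L_2(\Gamma_Q)$ and every $0\le t<2^{-k}$. -/

import Mathlib

set_option linter.unusedSectionVars false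

noncomputable section

namespace MixedQ

open scoped ComplexConjugate
open Equiv

/-- A structure matrix `Q = (q_ij)` of the mixed `q`-commutation relations: a real symmetric
matrix all of whose entries (the diagonal ones included) have absolute value less than `1`. -/
structure StructMatrix (ι : Type*) where
  mat : Matrix ι ι ℝ
  isSymm : mat.IsSymm
  abs_lt_one : ∀ i j, |mat i j| < 1

section Level
variable {ι : Type*} [Fintype ι] [DecidableEq ι] (Q : StructMatrix ι) {n : ℕ}

/-- The weight `∏ q(i_a, i_b)` over the crossings of the bipartite pairing `a ↦ σ a`, that is,
over the pairs `a < b` whose order is reversed by `σ`. -/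
def crossWeight (i : Fin n → ι) (σ : Perm (Fin n)) : ℝ :=
  ∏ a, ∏ b, if a < b ∧ σ b < σ a then Q.mat (i a) (i b) else 1

/-- The (semi-)inner product on tensors of length `n`, a tensor being given by its coordinates
`f = ∑ i, f i • e_{i_1} ⊗ ⋯ ⊗ e_{i_n}`. On words it is
`⟨e_i, e_k⟩ = ∑ σ, ∏_{a < b, σ b < σ a} q(i_a, i_b)`, the sum being over the bijections `σ` with
`k_{σ a} = i_a` for all `a`. It is conjugate linear in the first variable. -/
def levelInner (f g : (Fin n → ι) → ℂ) : ℂ :=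
  ∑ i, ∑ σ : Perm (Fin n), (crossWeight Q i σ : ℂ) * (conj (f i) * g (i ∘ σ.symm))

/-- Auxiliary for positivity: the weight of the pairs ordered differently by `u` and `v`. -/
def relWeight (i : Fin n → ι) (u v : Perm (Fin n)) : ℝ :=
  ∏ p : Fin n × Fin n with p.1 < p.2,
    if (u p.1 < u p.2 ↔ v p.1 < v p.2) then 1 else Q.mat (i p.1) (i p.2)

theorem relWeight_one (i : Fin n → ι) (σ : Perm (Fin n)) :
    relWeight Q i 1 σ = crossWeight Q i σ := by
  unfold relWeight crossWeight
  rw [Finset.prod_filter, ← Finset.univ_product_univ, Finset.prod_product]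
  refine Finset.prod_congr rfl fun a _ => Finset.prod_congr rfl fun b _ => ?_
  by_cases h : a < b
  · have : σ a ≠ σ b := fun e => h.ne (σ.injective e)
    by_cases h2 : σ a < σ b
    · simp [h, h2, h2.not_gt]
    · simp [h, h2, lt_of_le_of_ne (not_lt.mp h2) this.symm]
  · simp [h]

theorem relWeight_comm (i : Fin n → ι) (u v : Perm (Fin n)) :
    relWeight Q i u v = relWeight Q i v u := by
  unfold relWeight
  refine Finset.prod_congr rfl fun p _ => ?_
  simp only [iff_comm]

theorem relWeight_comp (i : Fin n → ι) (u v ρ : Perm (Fin n)) :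
    relWeight Q (i ∘ ρ) (u * ρ) (v * ρ) = relWeight Q i u v := by
  unfold relWeight
  have key : ∀ (w : Perm (Fin n)) (a b : Fin n), a ≠ b → (¬ w a < w b ↔ w b < w a) := by
    intro w a b hab
    have : w a ≠ w b := fun e => hab (w.injective e)
    rw [not_lt]
    exact ⟨fun h => lt_of_le_of_ne h this.symm, le_of_lt⟩
  refine Finset.prod_nbij' 
    (fun p => if ρ p.1 < ρ p.2 then (ρ p.1, ρ p.2) else (ρ p.2, ρ p.1))
    (fun p => if ρ.symm p.1 < ρ.symm p.2 then (ρ.symm p.1, ρ.symm p.2)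
      else (ρ.symm p.2, ρ.symm p.1)) ?_ ?_ ?_ ?_ ?_
  · rintro ⟨a, b⟩ h
    simp only [Finset.mem_filter, Finset.mem_univ, true_and] at h ⊢
    split_ifs with h1
    · exact h1
    · exact (key ρ a b h.ne).1 h1
  · rintro ⟨a, b⟩ h
    simp only [Finset.mem_filter, Finset.mem_univ, true_and] at h ⊢
    split_ifs with h1
    · exact h1
    · exact (key ρ.symm a b h.ne).1 h1
  · rintro ⟨a, b⟩ h
    simp only [Finset.mem_filter, Finset.mem_univ, true_and] at h ⊢
    split_ifs with h1 h2 h2 <;> simp_all [not_lt_of_gt]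
  · rintro ⟨a, b⟩ h
    simp only [Finset.mem_filter, Finset.mem_univ, true_and] at h ⊢
    split_ifs with h1 h2 h2 <;> simp_all [not_lt_of_gt]
  · rintro ⟨a, b⟩ h
    simp only [Finset.mem_filter, Finset.mem_univ, true_and] at h ⊢
    have hne : ρ a ≠ ρ b := fun e => h.ne (ρ.injective e)
    by_cases h1 : ρ a < ρ b
    · simp only [Perm.coe_mul, Function.comp_apply, h1, if_true]
      congr
    · simp only [Perm.coe_mul, Function.comp_apply, h1, if_false, 
        ← key u (ρ a) (ρ b) hne, ← key v (ρ a) (ρ b) hne, not_iff_not,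
        Q.isSymm.apply (i (ρ a)) (i (ρ b))]
      congr

theorem levelInner_symmetrized (f g : (Fin n → ι) → ℂ) :
    (Fintype.card (Perm (Fin n)) : ℂ) * levelInner Q f g =
      ∑ c : Fin n → ι, ∑ u : Perm (Fin n), ∑ v : Perm (Fin n),
        (relWeight Q c u v : ℂ) * (conj (f (c ∘ u.symm)) * g (c ∘ v.symm)) := by
  rw [Finset.sum_comm]
  have : ∀ u : Perm (Fin n), ∑ c : Fin n → ι, ∑ v : Perm (Fin n),
        (relWeight Q c u v : ℂ) * (conj (f (c ∘ u.symm)) * g (c ∘ v.symm)) =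
        levelInner Q f g := by
    intro u
    unfold levelInner
    refine (Fintype.sum_equiv (Equiv.arrowCongr u.symm (Equiv.refl ι)) _ _ fun i => ?_).symm
    refine Fintype.sum_equiv (Equiv.mulRight u) _ _ fun σ => ?_
    have h := relWeight_comp Q i 1 σ u
    rw [relWeight_one, one_mul] at h
    have e1 : (Equiv.arrowCongr u.symm (Equiv.refl ι)) i = i ∘ u := by
      ext a; simp [Equiv.arrowCongr]
    rw [e1, ← h]
    congr 2
    · congr 2; ext a; simp
    · congr 1; ext a; simp [Perm.mul_def]
  rw [Finset.sum_congr rfl fun u _ => this u]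
  simp

theorem relWeight_pos (c : Fin n → ι) (S : Finset (Fin n × Fin n)) :
    ∀ f : Perm (Fin n) → ℂ, 0 ≤ (∑ u, ∑ v,
      ((∏ p ∈ S, if (u p.1 < u p.2 ↔ v p.1 < v p.2) then 1 else Q.mat (c p.1) (c p.2) : ℝ) : ℂ) *
        (conj (f u) * f v)).re := by
  induction S using Finset.induction_on with
  | empty =>
    intro f
    simp only [Finset.prod_empty, Complex.ofReal_one, one_mul, ← Finset.mul_sum, ← Finset.sum_mul,
      ← map_sum]
    rw [← Complex.normSq_eq_conj_mul_self, Complex.ofReal_re]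
    exact Complex.normSq_nonneg _
  | insert p S hp ih =>
    intro f
    let s : Perm (Fin n) → ℂ := fun u => if u p.1 < u p.2 then 1 else -1
    set q : ℝ := Q.mat (c p.1) (c p.2)
    have hq := abs_lt.1 (Q.abs_lt_one (c p.1) (c p.2))
    have h1 := ih f
    have h2 := ih (fun u => s u * f u)
    have key : (∑ u, ∑ v,
      ((∏ p ∈ insert p S, if (u p.1 < u p.2 ↔ v p.1 < v p.2) then 1
        else Q.mat (c p.1) (c p.2) : ℝ) : ℂ) * (conj (f u) * f v)) =
      (((1 + q) / 2 : ℝ) : ℂ) * (∑ u, ∑ v,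
      ((∏ p ∈ S, if (u p.1 < u p.2 ↔ v p.1 < v p.2) then 1 else Q.mat (c p.1) (c p.2) : ℝ) : ℂ) *
        (conj (f u) * f v)) + (((1 - q) / 2 : ℝ) : ℂ) * (∑ u, ∑ v,
      ((∏ p ∈ S, if (u p.1 < u p.2 ↔ v p.1 < v p.2) then 1 else Q.mat (c p.1) (c p.2) : ℝ) : ℂ) *
        (conj (s u * f u) * (s v * f v))) := by
      simp only [Finset.mul_sum, ← Finset.sum_add_distrib]
      refine Finset.sum_congr rfl fun u _ => Finset.sum_congr rfl fun v _ => ?_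
      rw [Finset.prod_insert hp]
      simp only [s]
      by_cases hu : u p.1 < u p.2 <;> by_cases hv : v p.1 < v p.2 <;>
        simp only [hu, hv, if_true, if_false, iff_true, iff_false, not_true,
          map_mul, map_one, map_neg] <;> push_cast <;> ring
    rw [key, Complex.add_re, Complex.re_ofReal_mul, Complex.re_ofReal_mul]
    have := mul_nonneg (by linarith : (0:ℝ) ≤ (1 + q) / 2) h1
    have := mul_nonneg (by linarith : (0:ℝ) ≤ (1 - q) / 2) h2
    linarith

theorem levelInner_self_nonneg (f : (Fin n → ι) → ℂ) : 0 ≤ (levelInner Q f f).re := by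
  have h := congrArg Complex.re (levelInner_symmetrized Q f f)
  rw [← Complex.ofReal_natCast, Complex.re_ofReal_mul, Complex.re_sum] at h
  have h2 : 0 ≤ (Fintype.card (Perm (Fin n)) : ℝ) * (levelInner Q f f).re := by
    rw [h]
    exact Finset.sum_nonneg fun c _ => relWeight_pos Q c _ (fun u => f (c ∘ u.symm))
  exact nonneg_of_mul_nonneg_right h2 (by exact_mod_cast Fintype.card_pos)

theorem levelInner_conj (f g : (Fin n → ι) → ℂ) :
    conj (levelInner Q g f) = levelInner Q f g := by
  have hc : (Fintype.card (Perm (Fin n)) : ℂ) ≠ 0 := by exact_mod_cast Fintype.card_ne_zero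
  apply mul_left_cancel₀ hc
  rw [levelInner_symmetrized, ← Complex.conj_natCast, ← map_mul, levelInner_symmetrized]
  simp only [map_sum, map_mul, Complex.conj_ofReal, Complex.conj_conj]
  refine Finset.sum_congr rfl fun c _ => ?_
  rw [Finset.sum_comm]
  refine Finset.sum_congr rfl fun u _ => Finset.sum_congr rfl fun v _ => ?_
  rw [relWeight_comm, mul_comm (g _)]

theorem levelInner_add_left (f g h : (Fin n → ι) → ℂ) :
    levelInner Q (f + g) h = levelInner Q f h + levelInner Q g h := by
  simp only [levelInner, ← Finset.sum_add_distrib, Pi.add_apply, map_add]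
  refine Finset.sum_congr rfl fun c _ => Finset.sum_congr rfl fun u _ => by ring

theorem levelInner_smul_left (r : ℂ) (f h : (Fin n → ι) → ℂ) :
    levelInner Q (r • f) h = conj r * levelInner Q f h := by
  simp only [levelInner, Finset.mul_sum, Pi.smul_apply, map_mul, smul_eq_mul]
  refine Finset.sum_congr rfl fun c _ => Finset.sum_congr rfl fun u _ => by ring

/-- Left creation `f ↦ e_j ⊗ f`, in coordinates. -/
def levelCr (j : ι) (n : ℕ) : ((Fin n → ι) → ℂ) →ₗ[ℂ] ((Fin (n + 1) → ι) → ℂ) where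
  toFun f i := if i 0 = j then f (Fin.tail i) else 0
  map_add' f g := by ext i; simp only [Pi.add_apply]; split_ifs <;> simp
  map_smul' r f := by ext i; simp

/-- Left annihilation `e_v ↦ ∑_l δ_{j, v_l} ∏_{r < l} q(v_r, v_l) e_{v - v_l}`, in coordinates. -/
def levelAn (j : ι) (n : ℕ) : ((Fin (n + 1) → ι) → ℂ) →ₗ[ℂ] ((Fin n → ι) → ℂ) where
  toFun g w := ∑ l : Fin (n + 1),
    ((∏ r : Fin n, if r.castSucc < l then Q.mat j (w r) else 1 : ℝ) : ℂ) *
      g (Fin.insertNth (α := fun _ => ι) l j w)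
  map_add' f g := by ext i; simp [mul_add, Finset.sum_add_distrib]
  map_smul' r f := by
    ext i; simp only [Pi.smul_apply, smul_eq_mul, Finset.mul_sum, RingHom.id_apply]
    exact Finset.sum_congr rfl fun l _ => by ring

/-- The permutation `0 ↦ p`, `k + 1 ↦ p.succAbove (τ k)`. -/
def insPerm (x : Fin (n + 1) × Perm (Fin n)) : Perm (Fin (n + 1)) :=
  (Perm.decomposeFin.symm (0, x.2)).trans x.1.cycleRange.symm

theorem insPerm_zero (x : Fin (n + 1) × Perm (Fin n)) : insPerm x 0 = x.1 := by
  simp [insPerm]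

theorem insPerm_succ (x : Fin (n + 1) × Perm (Fin n)) (k : Fin n) :
    insPerm x k.succ = x.1.succAbove (x.2 k) := by
  simp [insPerm, Fin.cycleRange_symm_succ]

theorem insPerm_bijective : Function.Bijective (insPerm (n := n)) := by
  rw [Fintype.bijective_iff_injective_and_card]
  constructor
  · rintro ⟨p, τ⟩ ⟨p', τ'⟩ h
    have h0 : p = p' := by
      have := congrArg (fun e : Perm (Fin (n+1)) => e 0) h
      simpa [insPerm_zero] using this
    subst h0
    have h1 : τ = τ' := by
      ext k
      have := congrArg (fun e : Perm (Fin (n+1)) => e k.succ) h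
      simp only [insPerm_succ] at this
      exact congrArg Fin.val (Fin.succAbove_right_injective this)
    rw [h1]
  · simp [Fintype.card_perm, Nat.factorial_succ]

theorem crossWeight_insPerm (j : ι) (w : Fin n → ι) (x : Fin (n + 1) × Perm (Fin n)) :
    crossWeight Q (Fin.cons j w : Fin (n + 1) → ι) (insPerm x) =
      (∏ r : Fin n, if r.castSucc < x.1 then Q.mat j (w (x.2.symm r)) else 1) *
        crossWeight Q w x.2 := by
  unfold crossWeight
  rw [Fin.prod_univ_succ]
  congr 1
  · rw [Fin.prod_univ_succ]
    simp only [lt_self_iff_false, false_and, if_false, one_mul, Fin.succ_pos, true_and,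
      insPerm_zero, insPerm_succ, Fin.cons_zero, Fin.cons_succ]
    refine Fintype.prod_equiv x.2 _ _ fun a => ?_
    simp [Fin.succAbove_lt_iff_castSucc_lt]
  · refine Finset.prod_congr rfl fun a _ => ?_
    rw [Fin.prod_univ_succ]
    simp [insPerm_succ, Fin.succAbove_lt_succAbove_iff]

theorem cons_comp_insPerm (j : ι) (w : Fin n → ι) (x : Fin (n + 1) × Perm (Fin n)) :
    (Fin.cons j w : Fin (n + 1) → ι) ∘ (insPerm x).symm =
      Fin.insertNth (α := fun _ => ι) x.1 j (w ∘ x.2.symm) := by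
  rw [Fin.eq_insertNth_iff]
  constructor
  · have : (insPerm x).symm x.1 = 0 := by rw [Equiv.symm_apply_eq, insPerm_zero]
    simp [this]
  · ext k
    have : (insPerm x).symm (x.1.succAbove k) = (x.2.symm k).succ := by
      rw [Equiv.symm_apply_eq, insPerm_succ]; simp
    simp [Fin.removeNth, this]

theorem levelInner_cr (j : ι) (f : (Fin n → ι) → ℂ) (g : (Fin (n + 1) → ι) → ℂ) :
    levelInner Q (levelCr j n f) g = levelInner Q f (levelAn Q j n g) := by
  unfold levelInner
  rw [← (Fin.consEquiv (fun _ => ι)).sum_comp, Fintype.sum_prod_type]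
  rw [Finset.sum_eq_single j]
  rotate_left
  · intro b _ hb
    simp [levelCr, Fin.consEquiv, hb]
  · simp
  refine Finset.sum_congr rfl fun w _ => ?_
  rw [← (Equiv.ofBijective _ insPerm_bijective).sum_comp, Fintype.sum_prod_type, Finset.sum_comm]
  refine Finset.sum_congr rfl fun τ _ => ?_
  simp only [Equiv.ofBijective_apply, levelAn, levelCr, LinearMap.coe_mk, AddHom.coe_mk,
    Fin.consEquiv, Equiv.coe_fn_mk, Fin.cons_zero, if_true, Fin.tail_cons, crossWeight_insPerm,
    cons_comp_insPerm, Finset.mul_sum, Function.comp_apply]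
  refine Finset.sum_congr rfl fun l _ => ?_
  push_cast
  ring

theorem levelAn_cr (j : ι) (f : (Fin (n + 1) → ι) → ℂ) :
    levelAn Q j (n + 1) (levelCr j (n + 1) f) =
      f + (Q.mat j j : ℂ) • levelCr j n (levelAn Q j n f) := by
  ext w
  simp only [levelAn, levelCr, LinearMap.coe_mk, AddHom.coe_mk, Pi.add_apply, Pi.smul_apply,
    smul_eq_mul]
  rw [Fin.sum_univ_succ]
  congr 1
  · simp
  · obtain ⟨a, w, rfl⟩ : ∃ a v, w = Fin.cons a v := ⟨w 0, Fin.tail w, (Fin.cons_self_tail w).symm⟩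
    simp only [Fin.insertNth_succ_cons, Fin.cons_zero, Fin.tail_cons, mul_ite, mul_zero]
    split_ifs with h
    · subst h
      rw [Finset.mul_sum]
      refine Finset.sum_congr rfl fun l _ => ?_
      rw [Fin.prod_univ_succ]
      simp [mul_assoc]
    · simp

theorem levelAn_cr_zero (j : ι) (f : (Fin 0 → ι) → ℂ) :
    levelAn Q j 0 (levelCr j 0 f) = f := by
  ext w
  simp [levelAn, levelCr]

theorem crossWeight_congr {i k : Fin n → ι} (h : ∀ r j, Q.mat (i r) j = Q.mat (k r) j)
    (σ : Perm (Fin n)) : crossWeight Q i σ = crossWeight Q k σ := by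
  unfold crossWeight
  refine Finset.prod_congr rfl fun a _ => Finset.prod_congr rfl fun b _ => ?_
  rw [h a (i b), Q.isSymm.apply, h b (k a), Q.isSymm.apply]

/-- The tensor power `R ⊗ ⋯ ⊗ R`, where `R e_k = ∑ i, R i k • e_i`, in coordinates. -/
def levelMap (R : Matrix ι ι ℝ) (n : ℕ) : ((Fin n → ι) → ℂ) →ₗ[ℂ] ((Fin n → ι) → ℂ) where
  toFun f i := ∑ k : Fin n → ι, ((∏ r, R (i r) (k r) : ℝ) : ℂ) * f k
  map_add' f g := by ext i; simp [mul_add, Finset.sum_add_distrib]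
  map_smul' r f := by
    ext i; simp only [Pi.smul_apply, smul_eq_mul, Finset.mul_sum, RingHom.id_apply]
    exact Finset.sum_congr rfl fun l _ => by ring

theorem levelMap_one (f : (Fin n → ι) → ℂ) : levelMap 1 n f = f := by
  ext i
  simp only [levelMap, LinearMap.coe_mk, AddHom.coe_mk]
  rw [Finset.sum_eq_single i]
  · simp
  · intro k _ hk
    obtain ⟨r, hr⟩ := Function.ne_iff.1 hk
    have h0 : ∏ r, (1 : Matrix ι ι ℝ) (i r) (k r) = 0 :=
      Finset.prod_eq_zero (Finset.mem_univ r) (Matrix.one_apply_ne hr.symm)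
    rw [h0, Complex.ofReal_zero, zero_mul]
  · simp

theorem levelMap_mul (R S : Matrix ι ι ℝ) (f : (Fin n → ι) → ℂ) :
    levelMap (R * S) n f = levelMap R n (levelMap S n f) := by
  ext i
  simp only [levelMap, LinearMap.coe_mk, AddHom.coe_mk, Finset.mul_sum]
  rw [Finset.sum_comm]
  refine Finset.sum_congr rfl fun m _ => ?_
  simp only [Matrix.mul_apply]
  rw [Fintype.prod_sum, Complex.ofReal_sum, Finset.sum_mul]
  refine Finset.sum_congr rfl fun k _ => ?_
  rw [Finset.prod_mul_distrib]
  push_cast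
  ring

theorem levelInner_map (R : Matrix ι ι ℝ)
    (hR : ∀ i k, R i k ≠ 0 → ∀ j, Q.mat i j = Q.mat k j) (f g : (Fin n → ι) → ℂ) :
    levelInner Q (levelMap R n f) g = levelInner Q f (levelMap R.transpose n g) := by
  unfold levelInner
  simp only [levelMap, LinearMap.coe_mk, AddHom.coe_mk, map_sum, map_mul, Complex.conj_ofReal,
    Finset.sum_mul, Finset.mul_sum]
  rw [Finset.sum_congr rfl fun i _ => Finset.sum_comm, Finset.sum_comm]
  refine Finset.sum_congr rfl fun k _ => ?_
  rw [Finset.sum_comm]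
  refine Finset.sum_congr rfl fun σ _ => ?_
  refine Fintype.sum_equiv (Equiv.arrowCongr σ (Equiv.refl ι)) _ _ fun i => ?_
  have e1 : (Equiv.arrowCongr σ (Equiv.refl ι)) i = i ∘ σ.symm := by
    ext a; simp [Equiv.arrowCongr]
  rw [e1]
  have e2 : ∏ r, R.transpose ((k ∘ σ.symm) r) ((i ∘ σ.symm) r) = ∏ r, R (i r) (k r) := by
    simp only [Matrix.transpose_apply, Function.comp_apply]
    exact σ.symm.prod_comp fun r => R (i r) (k r)
  rw [e2]
  by_cases h : ∏ r, R (i r) (k r) = 0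
  · simp [h]
  · have h' : ∀ r, R (i r) (k r) ≠ 0 := fun r hr =>
      h (Finset.prod_eq_zero (Finset.mem_univ r) hr)
    rw [crossWeight_congr Q (fun r j => hR _ _ (h' r) j)]
    ring

theorem levelMap_cr (R : Matrix ι ι ℝ) (j : ι) (f : (Fin n → ι) → ℂ) :
    levelMap R (n + 1) (levelCr j n f) =
      ∑ m, (R m j : ℂ) • levelCr m n (levelMap R n f) := by
  ext i
  obtain ⟨a, w, rfl⟩ : ∃ a v, i = Fin.cons a v := ⟨i 0, Fin.tail i, (Fin.cons_self_tail i).symm⟩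
  simp only [levelMap, levelCr, LinearMap.coe_mk, AddHom.coe_mk, Finset.sum_apply, Pi.smul_apply,
    smul_eq_mul, Fin.cons_zero, Fin.tail_cons, mul_ite, mul_zero, Finset.sum_ite_eq,
    Finset.mem_univ, if_true]
  rw [← (Fin.consEquiv (fun _ => ι)).sum_comp, Fintype.sum_prod_type, Finset.sum_eq_single j]
  · simp only [Fin.consEquiv, Equiv.coe_fn_mk, Fin.cons_zero, if_true, Fin.tail_cons,
      Fin.prod_univ_succ, Fin.cons_succ, Finset.mul_sum]
    refine Finset.sum_congr rfl fun k _ => ?_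
    push_cast; ring
  · intro b _ hb
    simp [Fin.consEquiv, hb]
  · simp

theorem levelInner_sub_self (s : ℝ) (x y : (Fin n → ι) → ℂ) :
    (levelInner Q ((s : ℂ) • x + y) ((s : ℂ) • x + y)).re =
      s ^ 2 * (levelInner Q x x).re + 2 * s * (levelInner Q x y).re + (levelInner Q y y).re := by
  have hr : ∀ z, levelInner Q z ((s : ℂ) • x + y) =
      (s : ℂ) * levelInner Q z x + levelInner Q z y := by
    intro z
    rw [← levelInner_conj, levelInner_add_left, levelInner_smul_left, map_add, map_mul,
      levelInner_conj, levelInner_conj, Complex.conj_conj]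
  have hyx : (levelInner Q y x).re = (levelInner Q x y).re := by
    rw [← levelInner_conj Q y x, Complex.conj_re]
  rw [levelInner_add_left, levelInner_smul_left, hr, hr, Complex.conj_ofReal]
  simp only [Complex.add_re, Complex.re_ofReal_mul, hyx]
  ring

/-- A bound for the square of the norm of the creation operator. -/
def crBound (j : ι) : ℝ := 1 / (1 - |Q.mat j j|)

theorem crBound_eq (j : ι) : 1 + |Q.mat j j| * crBound Q j = crBound Q j := by
  have := Q.abs_lt_one j j
  have : 1 - |Q.mat j j| ≠ 0 := by linarith
  unfold crBound
  field_simp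
  ring

theorem one_le_crBound (j : ι) : 1 ≤ crBound Q j := by
  have := Q.abs_lt_one j j
  unfold crBound
  rw [le_div_iff₀ (by linarith)]
  linarith [abs_nonneg (Q.mat j j)]

theorem levelAn_bound (j : ι) (n : ℕ)
    (h : ∀ f : (Fin n → ι) → ℂ, (levelInner Q (levelCr j n f) (levelCr j n f)).re ≤
      crBound Q j * (levelInner Q f f).re) (f : (Fin (n + 1) → ι) → ℂ) :
    (levelInner Q (levelAn Q j n f) (levelAn Q j n f)).re ≤
      crBound Q j * (levelInner Q f f).re := by
  set M := crBound Q j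
  have hM : 1 ≤ M := one_le_crBound Q j
  set B := (levelInner Q (levelAn Q j n f) (levelAn Q j n f)).re
  have h1 := h (levelAn Q j n f)
  have h2 := levelInner_self_nonneg Q (((-(1 / M) : ℝ) : ℂ) • levelCr j n (levelAn Q j n f) + f)
  rw [levelInner_sub_self, levelInner_cr Q j _ f] at h2
  have h3 : (-(1 / M)) ^ 2 * (levelInner Q (levelCr j n (levelAn Q j n f))
      (levelCr j n (levelAn Q j n f))).re ≤ (-(1 / M)) ^ 2 * (M * B) :=
    mul_le_mul_of_nonneg_left h1 (sq_nonneg _)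
  have h4 : (-(1 / M)) ^ 2 * (M * B) = B / M := by field_simp
  have h5 : 0 ≤ (levelInner Q f f).re - B / M := by
    have : 2 * (-(1 / M)) * B = -(2 * (B / M)) := by ring
    change 0 ≤ _ + 2 * (-(1 / M)) * B + _ at h2
    linarith
  have h6 : B / M ≤ (levelInner Q f f).re := by linarith
  rw [div_le_iff₀ (by linarith)] at h6
  linarith

theorem levelCr_bound (j : ι) (n : ℕ) : ∀ f : (Fin n → ι) → ℂ,
    (levelInner Q (levelCr j n f) (levelCr j n f)).re ≤ crBound Q j * (levelInner Q f f).re := by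
  induction n with
  | zero =>
    intro f
    rw [levelInner_cr, levelAn_cr_zero]
    nlinarith [levelInner_self_nonneg Q f, one_le_crBound Q j]
  | succ n ih =>
    intro f
    have h1 := levelAn_bound Q j n ih f
    rw [levelInner_cr, levelAn_cr, ← levelInner_conj, levelInner_add_left, levelInner_smul_left,
      levelInner_cr, Complex.conj_re, Complex.conj_ofReal, Complex.add_re, Complex.re_ofReal_mul]
    have h2 := levelInner_self_nonneg Q (levelAn Q j n f)
    have h3 : Q.mat j j * (levelInner Q (levelAn Q j n f) (levelAn Q j n f)).re ≤
        |Q.mat j j| * (levelInner Q (levelAn Q j n f) (levelAn Q j n f)).re :=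
      mul_le_mul_of_nonneg_right (le_abs_self _) h2
    have h4 := mul_le_mul_of_nonneg_left h1 (abs_nonneg (Q.mat j j))
    have h5 := crBound_eq Q j
    calc _ ≤ (levelInner Q f f).re + |Q.mat j j| * (crBound Q j * (levelInner Q f f).re) := by
          linarith
      _ = (1 + |Q.mat j j| * crBound Q j) * (levelInner Q f f).re := by ring
      _ = _ := by rw [h5]

end Level

section Fock
variable {ι : Type*} [Fintype ι] [DecidableEq ι] (Q : StructMatrix ι)

/-- The algebraic Fock space `⨁_n (ℂ^ι)^{⊗ n}`, with the semi-inner product twisted by `Q`. -/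
def PreFock (_Q : StructMatrix ι) : Type _ := Π₀ n : ℕ, ((Fin n → ι) → ℂ)

instance : AddCommGroup (PreFock Q) := inferInstanceAs (AddCommGroup (Π₀ n, ((Fin n → ι) → ℂ)))
instance : Module ℂ (PreFock Q) := inferInstanceAs (Module ℂ (Π₀ n, ((Fin n → ι) → ℂ)))

variable {Q} in
/-- The component of length `n`. -/
def PreFock.comp (n : ℕ) : PreFock Q →ₗ[ℂ] ((Fin n → ι) → ℂ) := DFinsupp.lapply n

/-- The inclusion of the tensors of length `n`. -/
def PreFock.of (n : ℕ) : ((Fin n → ι) → ℂ) →ₗ[ℂ] PreFock Q :=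
  DFinsupp.lsingle (M := fun n => (Fin n → ι) → ℂ) n

variable {Q} in
theorem PreFock.ext {f g : PreFock Q} (h : ∀ n, f.comp n = g.comp n) : f = g := DFinsupp.ext h

variable {Q} in
theorem PreFock.exists_bound (f : PreFock Q) : ∃ N, ∀ n, N ≤ n → f.comp n = 0 := by
  classical
  obtain ⟨N, hN⟩ := (DFinsupp.support f).exists_nat_subset_range
  refine ⟨N, fun n hn => ?_⟩
  by_contra h
  have := Finset.mem_range.1 (hN ((DFinsupp.mem_support_iff).2 h))
  omega

variable {Q} in
open Classical in
/-- Tensors of different lengths are orthogonal. -/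
def PreFock.inner (f g : PreFock Q) : ℂ :=
  ∑ n ∈ DFinsupp.support f, levelInner Q (f.comp n) (g.comp n)

theorem levelInner_zero_left {n : ℕ} (g : (Fin n → ι) → ℂ) : levelInner Q 0 g = 0 := by
  simp [levelInner]

variable {Q} in
theorem PreFock.inner_eq (f g : PreFock Q) (N : ℕ) (h : ∀ n, N ≤ n → f.comp n = 0) :
    f.inner g = ∑ n ∈ Finset.range N, levelInner Q (f.comp n) (g.comp n) := by
  classical
  unfold PreFock.inner
  apply Finset.sum_subset_zero_on_sdiff
  · intro n hn
    rw [Finset.mem_range]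
    by_contra hc
    exact (DFinsupp.mem_support_iff.1 hn) (h n (by omega))
  · intro n hn
    have : f.comp n = 0 := by
      by_contra hc
      exact (Finset.mem_sdiff.1 hn).2 (DFinsupp.mem_support_iff.2 hc)
    rw [this, levelInner_zero_left]
  · intro n hn
    rfl

/-- The semi-inner product of the algebraic Fock space. -/
abbrev preFockCore : PreInnerProductSpace.Core ℂ (PreFock Q) where
  inner := PreFock.inner
  conj_inner_symm f g := by
    obtain ⟨N, hN⟩ := f.exists_bound
    obtain ⟨N', hN'⟩ := g.exists_bound
    rw [PreFock.inner_eq f g (max N N') fun n hn => hN n (le_trans (le_max_left _ _) hn),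
      PreFock.inner_eq g f (max N N') fun n hn => hN' n (le_trans (le_max_right _ _) hn), map_sum]
    exact Finset.sum_congr rfl fun n _ => levelInner_conj Q _ _
  re_inner_nonneg f := by
    change 0 ≤ (PreFock.inner f f).re
    obtain ⟨N, hN⟩ := f.exists_bound
    rw [PreFock.inner_eq f f N hN, Complex.re_sum]
    exact Finset.sum_nonneg fun n _ => levelInner_self_nonneg Q _
  add_left f g h := by
    obtain ⟨N, hN⟩ := f.exists_bound
    obtain ⟨N', hN'⟩ := g.exists_bound
    have h1 : ∀ n, max N N' ≤ n → f.comp n = 0 := fun n hn => hN n (le_trans (le_max_left _ _) hn)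
    have h2 : ∀ n, max N N' ≤ n → g.comp n = 0 := fun n hn => hN' n (le_trans (le_max_right _ _) hn)
    rw [PreFock.inner_eq f h _ h1, PreFock.inner_eq g h _ h2, PreFock.inner_eq (f + g) h (max N N')
      fun n hn => by rw [map_add, h1 n hn, h2 n hn, add_zero], ← Finset.sum_add_distrib]
    exact Finset.sum_congr rfl fun n _ => by rw [map_add, levelInner_add_left]
  smul_left f g r := by
    obtain ⟨N, hN⟩ := f.exists_bound
    rw [PreFock.inner_eq f g _ hN, PreFock.inner_eq (r • f) g N
      fun n hn => by rw [map_smul, hN n hn, smul_zero], Finset.mul_sum]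
    exact Finset.sum_congr rfl fun n _ => by rw [map_smul, levelInner_smul_left]

instance : SeminormedAddCommGroup (PreFock Q) :=
  InnerProductSpace.Core.toSeminormedAddCommGroup (c := preFockCore Q)
instance : InnerProductSpace ℂ (PreFock Q) := InnerProductSpace.ofCore (preFockCore Q)

theorem PreFock.inner_def (f g : PreFock Q) : Inner.inner ℂ f g = f.inner g := rfl

theorem PreFock.norm_sq_eq (f : PreFock Q) : ‖f‖ ^ 2 = (f.inner f).re := by
  rw [← PreFock.inner_def]; exact norm_sq_eq_re_inner (𝕜 := ℂ) f

/-- The mixed `q`-Fock space (separated completion of the algebraic Fock space). -/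
abbrev Fock : Type _ := UniformSpace.Completion (PreFock Q)

/-- Left creation on the algebraic Fock space. -/
def preCr (j : ι) : PreFock Q →ₗ[ℂ] PreFock Q :=
  DFinsupp.lsum ℂ (M := fun n => (Fin n → ι) → ℂ)
    fun n => (PreFock.of Q (n + 1)).comp (levelCr j n)

theorem preCr_of (j : ι) (n : ℕ) (f : (Fin n → ι) → ℂ) :
    preCr Q j (PreFock.of Q n f) = PreFock.of Q (n + 1) (levelCr j n f) :=
  DFinsupp.lsum_single (M := fun n => (Fin n → ι) → ℂ) ℂ
    (fun n => (PreFock.of Q (n + 1)).comp (levelCr j n)) n f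

theorem PreFock.comp_of_self (n : ℕ) (f : (Fin n → ι) → ℂ) :
    (PreFock.of Q n f).comp n = f :=
  DFinsupp.single_eq_same (β := fun n => (Fin n → ι) → ℂ)

theorem PreFock.comp_of_ne {m n : ℕ} (h : m ≠ n) (f : (Fin n → ι) → ℂ) :
    (PreFock.of Q n f).comp m = 0 :=
  DFinsupp.single_eq_of_ne (β := fun n => (Fin n → ι) → ℂ) h

variable {Q} in
theorem PreFock.lin_ext {M : Type*} [AddCommGroup M] [Module ℂ M] {S T : PreFock Q →ₗ[ℂ] M}
    (h : ∀ n f, S (PreFock.of Q n f) = T (PreFock.of Q n f)) : S = T :=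
  DFinsupp.lhom_ext (M := fun n => (Fin n → ι) → ℂ) h

theorem preCr_comp_zero (j : ι) (f : PreFock Q) : (preCr Q j f).comp 0 = 0 := by
  have : (PreFock.comp 0).comp (preCr Q j) = 0 := PreFock.lin_ext fun n f => by
    simp [preCr_of, PreFock.comp_of_ne Q (Nat.succ_ne_zero n).symm]
  exact LinearMap.congr_fun this f

theorem preCr_comp_succ (j : ι) (n : ℕ) (f : PreFock Q) :
    (preCr Q j f).comp (n + 1) = levelCr j n (f.comp n) := by
  have : (PreFock.comp (n + 1)).comp (preCr Q j) = (levelCr j n).comp (PreFock.comp n) :=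
    PreFock.lin_ext fun m f => by
      simp only [LinearMap.comp_apply, preCr_of]
      by_cases h : n = m
      · subst h; rw [PreFock.comp_of_self, PreFock.comp_of_self]
      · rw [PreFock.comp_of_ne Q h, PreFock.comp_of_ne Q (by omega), map_zero]
  exact LinearMap.congr_fun this f

theorem preCr_norm (j : ι) (f : PreFock Q) : ‖preCr Q j f‖ ≤ √(crBound Q j) * ‖f‖ := by
  have hM := one_le_crBound Q j
  rw [← sq_le_sq₀ (norm_nonneg _) (by positivity), mul_pow, Real.sq_sqrt (by linarith),
    PreFock.norm_sq_eq, PreFock.norm_sq_eq]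
  obtain ⟨N, hN⟩ := f.exists_bound
  rw [PreFock.inner_eq f f N hN, PreFock.inner_eq _ _ (N + 1), Finset.sum_range_succ',
    preCr_comp_zero, levelInner_zero_left, add_zero, Complex.re_sum, Complex.re_sum, Finset.mul_sum]
  · refine Finset.sum_le_sum fun n _ => ?_
    rw [preCr_comp_succ]
    exact levelCr_bound Q j n _
  · rintro (_ | n) hn
    · omega
    · rw [preCr_comp_succ, hN n (by omega), map_zero]

/-- The left creation operator `c_j`, a bounded operator on the Fock space. -/
def creation (j : ι) : Fock Q →L[ℂ] Fock Q :=
  ((preCr Q j).mkContinuous _ (preCr_norm Q j)).completion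

/-- The mixed `q`-Gaussian variable `s_j = c_j + c_j^*`. -/
def gaussian (j : ι) : Fock Q →L[ℂ] Fock Q :=
  creation Q j + ContinuousLinearMap.adjoint (creation Q j)

/-- The vacuum vector `Ω`. -/
def vacuum : Fock Q := (PreFock.of Q 0 fun _ => 1 : PreFock Q)

/-- The orthogonal matrices on which the second quantization functor is defined: `R` only mixes
indices with identical rows in `Q`. -/
structure IsAdmissible (R : Matrix ι ι ℝ) : Prop where
  mul_transpose : R * R.transpose = 1
  compat : ∀ i k, R i k ≠ 0 → ∀ j, Q.mat i j = Q.mat k j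

variable {Q}
theorem IsAdmissible.transpose {R : Matrix ι ι ℝ} (h : IsAdmissible Q R) :
    IsAdmissible Q R.transpose where
  mul_transpose := by
    rw [Matrix.transpose_transpose]; exact mul_eq_one_comm.1 h.mul_transpose
  compat i k hik j := (h.compat k i hik j).symm

variable (Q) in
/-- `⨁_n R^{⊗ n}` on the algebraic Fock space. -/
def preMap (R : Matrix ι ι ℝ) : PreFock Q →ₗ[ℂ] PreFock Q :=
  DFinsupp.mapRange.linearMap (fun n => levelMap R n)

theorem preMap_comp (R : Matrix ι ι ℝ) (f : PreFock Q) (n : ℕ) :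
    (preMap Q R f).comp n = levelMap R n (f.comp n) := rfl

theorem preMap_inner {R : Matrix ι ι ℝ} (h : IsAdmissible Q R) (f g : PreFock Q) :
    (preMap Q R f).inner g = f.inner (preMap Q R.transpose g) := by
  obtain ⟨N, hN⟩ := f.exists_bound
  rw [PreFock.inner_eq f _ N hN, PreFock.inner_eq _ _ N
    fun n hn => by rw [preMap_comp, hN n hn, map_zero]]
  exact Finset.sum_congr rfl fun n _ => by
    rw [preMap_comp, preMap_comp, levelInner_map Q R h.compat]

theorem preMap_mul (R S : Matrix ι ι ℝ) (f : PreFock Q) :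
    preMap Q (R * S) f = preMap Q R (preMap Q S f) :=
  PreFock.ext fun n => by simp only [preMap_comp, levelMap_mul]

theorem preMap_one (f : PreFock Q) : preMap Q 1 f = f :=
  PreFock.ext fun n => by simp only [preMap_comp, levelMap_one]

theorem preMap_norm {R : Matrix ι ι ℝ} (h : IsAdmissible Q R) (f : PreFock Q) :
    ‖preMap Q R f‖ = ‖f‖ := by
  rw [← sq_eq_sq₀ (norm_nonneg _) (norm_nonneg _), PreFock.norm_sq_eq, PreFock.norm_sq_eq,
    preMap_inner h, ← preMap_mul, mul_eq_one_comm.1 h.mul_transpose, preMap_one]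

theorem preMap_cr (R : Matrix ι ι ℝ) (j : ι) (f : PreFock Q) :
    preMap Q R (preCr Q j f) = ∑ m, (R m j : ℂ) • preCr Q m (preMap Q R f) := by
  refine PreFock.ext fun n => ?_
  rcases n with _ | n
  · rw [preMap_comp, preCr_comp_zero, map_zero, map_sum]
    simp [preCr_comp_zero]
  · rw [preMap_comp, preCr_comp_succ, levelMap_cr, map_sum]
    simp [preCr_comp_succ, preMap_comp]

/-- The unitary `⨁_n R^{⊗ n}` of the Fock space. -/
def fockMap (R : Matrix ι ι ℝ) (h : IsAdmissible Q R) : Fock Q →L[ℂ] Fock Q :=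
  ((preMap Q R).mkContinuous 1 fun f => by rw [preMap_norm h, one_mul]).completion

theorem fockMap_coe {R : Matrix ι ι ℝ} (h : IsAdmissible Q R) (f : PreFock Q) :
    fockMap R h f = (preMap Q R f : PreFock Q) :=
  ContinuousLinearMap.completion_apply_coe _ f

theorem creation_coe (j : ι) (f : PreFock Q) :
    creation Q j f = (preCr Q j f : PreFock Q) :=
  ContinuousLinearMap.completion_apply_coe _ f

theorem Fock.clm_ext {S T : Fock Q →L[ℂ] Fock Q} (h : ∀ f : PreFock Q, S f = T f) : S = T := by
  ext x
  induction x using UniformSpace.Completion.induction_on with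
  | hp => exact isClosed_eq S.continuous T.continuous
  | ih f => exact h f

theorem fockMap_adjoint {R : Matrix ι ι ℝ} (h : IsAdmissible Q R) :
    ContinuousLinearMap.adjoint (fockMap R h) = fockMap R.transpose h.transpose := by
  symm
  rw [ContinuousLinearMap.eq_adjoint_iff]
  intro x y
  induction x, y using UniformSpace.Completion.induction_on₂ with
  | hp => exact isClosed_eq (by fun_prop) (by fun_prop)
  | ih f g =>
    rw [fockMap_coe, fockMap_coe, UniformSpace.Completion.inner_coe,
      UniformSpace.Completion.inner_coe, PreFock.inner_def, PreFock.inner_def,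
      preMap_inner h.transpose, Matrix.transpose_transpose]

theorem fockMap_mul_adjoint {R : Matrix ι ι ℝ} (h : IsAdmissible Q R) :
    fockMap R h * ContinuousLinearMap.adjoint (fockMap R h) = 1 := by
  rw [fockMap_adjoint]
  refine Fock.clm_ext fun f => ?_
  rw [mul_apply_eq_comp, fockMap_coe, fockMap_coe, ← preMap_mul, h.mul_transpose,
    preMap_one]
  rfl

theorem fockMap_adjoint_mul {R : Matrix ι ι ℝ} (h : IsAdmissible Q R) :
    ContinuousLinearMap.adjoint (fockMap R h) * fockMap R h = 1 := by
  rw [fockMap_adjoint]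
  refine Fock.clm_ext fun f => ?_
  rw [mul_apply_eq_comp, fockMap_coe, fockMap_coe, ← preMap_mul,
    mul_eq_one_comm.1 h.mul_transpose, preMap_one]
  rfl

theorem fockMap_creation {R : Matrix ι ι ℝ} (h : IsAdmissible Q R) (j : ι) :
    fockMap R h * creation Q j = (∑ m, (R m j : ℂ) • creation Q m) * fockMap R h := by
  refine Fock.clm_ext fun f => ?_
  simp only [mul_apply_eq_comp, fockMap_coe, creation_coe, preMap_cr,
    sum_apply, smul_apply, ← UniformSpace.Completion.coe_smul]
  exact map_sum (UniformSpace.Completion.toComplₗᵢ (𝕜 := ℂ) (E := PreFock Q)) _ _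

theorem fockMap_vacuum {R : Matrix ι ι ℝ} (h : IsAdmissible Q R) :
    fockMap R h (vacuum Q) = vacuum Q := by
  unfold vacuum
  rw [fockMap_coe]
  congr 1
  refine PreFock.ext fun n => ?_
  rw [preMap_comp]
  rcases n with _ | n
  · rw [PreFock.comp_of_self]
    ext i
    simp [levelMap]
  · rw [PreFock.comp_of_ne Q (Nat.succ_ne_zero n), map_zero]

theorem fockMap_gaussian {R : Matrix ι ι ℝ} (h : IsAdmissible Q R) (j : ι) :
    fockMap R h * gaussian Q j * star (fockMap R h) = ∑ m, (R m j : ℂ) • gaussian Q m := by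
  have h1 : fockMap R h * creation Q j * star (fockMap R h) = ∑ m, (R m j : ℂ) • creation Q m := by
    rw [ContinuousLinearMap.star_eq_adjoint, fockMap_creation, mul_assoc, fockMap_mul_adjoint,
      mul_one]
  have h2 := congrArg star h1
  rw [star_mul, star_mul, star_star, star_sum, ← mul_assoc] at h2
  unfold gaussian
  rw [mul_add, add_mul, h1, ← ContinuousLinearMap.star_eq_adjoint, h2, ← Finset.sum_add_distrib]
  refine Finset.sum_congr rfl fun m _ => ?_
  rw [star_smul, smul_add, ContinuousLinearMap.star_eq_adjoint]
  simp

end Fock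

section Algebra
variable {ι : Type*} [Fintype ι] [DecidableEq ι] (Q : StructMatrix ι)

/-- The mixed `q`-Gaussian von Neumann algebra `Γ_Q`, generated by the variables `s_j`
(as the bicommutant of these self-adjoint operators). -/
def vonNeumann : VonNeumannAlgebra (Fock Q) where
  toStarSubalgebra := StarSubalgebra.centralizer ℂ
    (StarSubalgebra.centralizer ℂ (Set.range (gaussian Q)) : Set (Fock Q →L[ℂ] Fock Q))
  centralizer_centralizer' := by
    change Set.centralizer (Set.centralizer ((StarSubalgebra.centralizer ℂ
      (StarSubalgebra.centralizer ℂ (Set.range (gaussian Q)) : Set (Fock Q →L[ℂ] Fock Q)) :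
        StarSubalgebra ℂ (Fock Q →L[ℂ] Fock Q)) : Set (Fock Q →L[ℂ] Fock Q))) = 
        ((StarSubalgebra.centralizer ℂ
      (StarSubalgebra.centralizer ℂ (Set.range (gaussian Q)) : Set (Fock Q →L[ℂ] Fock Q)) :
        StarSubalgebra ℂ (Fock Q →L[ℂ] Fock Q)) : Set (Fock Q →L[ℂ] Fock Q))
    rw [StarSubalgebra.coe_centralizer_centralizer, Set.centralizer_centralizer_centralizer]

/-- `Γ_Q` as a star-algebra. -/
abbrev GammaQ : StarSubalgebra ℂ (Fock Q →L[ℂ] Fock Q) := (vonNeumann Q).toStarSubalgebra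

theorem gaussian_star (j : ι) : star (gaussian Q j) = gaussian Q j := by
  unfold gaussian
  rw [star_add, ← ContinuousLinearMap.star_eq_adjoint, star_star, add_comm]

theorem mem_commutant_iff (y : Fock Q →L[ℂ] Fock Q) :
    y ∈ StarSubalgebra.centralizer ℂ (Set.range (gaussian Q)) ↔
      ∀ j, gaussian Q j * y = y * gaussian Q j := by
  rw [StarSubalgebra.mem_centralizer_iff]
  simp [gaussian_star]

theorem mem_gam_iff (x : Fock Q →L[ℂ] Fock Q) :
    x ∈ GammaQ Q ↔ ∀ y : Fock Q →L[ℂ] Fock Q, (∀ j, gaussian Q j * y = y * gaussian Q j) →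
      y * x = x * y := by
  change x ∈ StarSubalgebra.centralizer ℂ
    (StarSubalgebra.centralizer ℂ (Set.range (gaussian Q)) : Set (Fock Q →L[ℂ] Fock Q)) ↔ _
  rw [StarSubalgebra.mem_centralizer_iff]
  constructor
  · intro h y hy
    exact (h y ((mem_commutant_iff Q y).2 hy)).1
  · intro h y hy
    exact ⟨h y ((mem_commutant_iff Q y).1 hy),
      h (star y) ((mem_commutant_iff Q _).1 (star_mem hy))⟩

/-- `s_j` as an element of `Γ_Q`. -/
def gen (j : ι) : GammaQ Q := ⟨gaussian Q j, (mem_gam_iff Q _).2 fun _ hy => (hy j).symm⟩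

/-- The canonical trace `τ_Q(x) = ⟨Ω, x Ω⟩`. -/
def tau (x : GammaQ Q) : ℂ := Inner.inner ℂ (vacuum Q) ((x : Fock Q →L[ℂ] Fock Q) (vacuum Q))

variable {Q} in
theorem conj_mem {R : Matrix ι ι ℝ} (h : IsAdmissible Q R) {x : Fock Q →L[ℂ] Fock Q}
    (hx : x ∈ GammaQ Q) : fockMap R h * x * star (fockMap R h) ∈ GammaQ Q := by
  rw [mem_gam_iff] at hx ⊢
  intro y hy
  set V := fockMap R h
  have hV1 : star V * V = 1 := fockMap_adjoint_mul h
  have hV2 : V * star V = 1 := fockMap_mul_adjoint h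
  have key : ∀ j, gaussian Q j * (star V * y * V) = (star V * y * V) * gaussian Q j := by
    intro j
    have hs : V * gaussian Q j = (∑ m, (R m j : ℂ) • gaussian Q m) * V := by
      rw [← fockMap_gaussian h, mul_assoc, hV1, mul_one]
    have hs' : gaussian Q j * star V = star V * (∑ m, (R m j : ℂ) • gaussian Q m) := by
      rw [← fockMap_gaussian h, ← mul_assoc, ← mul_assoc, hV1, one_mul]
    have hy' : (∑ m, (R m j : ℂ) • gaussian Q m) * y = y * ∑ m, (R m j : ℂ) • gaussian Q m := by
      rw [Finset.sum_mul, Finset.mul_sum]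
      exact Finset.sum_congr rfl fun m _ => by rw [smul_mul_assoc, hy m, mul_smul_comm]
    calc gaussian Q j * (star V * y * V) = (gaussian Q j * star V) * y * V := by
          simp only [mul_assoc]
      _ = star V * ((∑ m, (R m j : ℂ) • gaussian Q m) * y) * V := by rw [hs']; simp only [mul_assoc]
      _ = star V * y * (V * gaussian Q j) := by rw [hy', hs]; simp only [mul_assoc]
      _ = _ := by simp only [mul_assoc]
  have h1 := hx _ key
  calc y * (V * x * star V) = (V * star V) * y * (V * x * star V) := by rw [hV2, one_mul]
    _ = V * ((star V * y * V) * x) * star V := by simp only [mul_assoc]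
    _ = V * (x * (star V * y * V)) * star V := by rw [h1]
    _ = V * x * star V * y * (V * star V) := by simp only [mul_assoc]
    _ = _ := by rw [hV2, mul_one]

variable {Q} in
theorem star_fockMap {R : Matrix ι ι ℝ} (h : IsAdmissible Q R) :
    star (fockMap R h) = fockMap R.transpose h.transpose := fockMap_adjoint h

variable {Q} in
theorem star_fockMap_mul {R : Matrix ι ι ℝ} (h : IsAdmissible Q R) :
    star (fockMap R h) * fockMap R h = 1 := fockMap_adjoint_mul h

variable {Q} in
theorem fockMap_mul_star {R : Matrix ι ι ℝ} (h : IsAdmissible Q R) :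
    fockMap R h * star (fockMap R h) = 1 := fockMap_mul_adjoint h

variable {Q} in
/-- The second quantization `Γ_Q(R)`, the automorphism `x ↦ F x F^*` of `Γ_Q` with
`F = ⨁_n R^{⊗ n}`. It maps `s_j` to `∑ m, R m j • s_m` and preserves the trace. -/
def secondQuant (R : Matrix ι ι ℝ) (h : IsAdmissible Q R) : GammaQ Q ≃⋆ₐ[ℂ] GammaQ Q where
  toFun x := ⟨fockMap R h * x * star (fockMap R h), conj_mem h x.2⟩
  invFun x := ⟨star (fockMap R h) * x * fockMap R h, by
    have := conj_mem h.transpose x.2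
    rwa [← star_fockMap h, star_star] at this⟩
  left_inv x := by
    ext1
    change star (fockMap R h) * (fockMap R h * x * star (fockMap R h)) * fockMap R h = x
    calc _ = (star (fockMap R h) * fockMap R h) * x * (star (fockMap R h) * fockMap R h) := by
          simp only [mul_assoc]
      _ = x := by rw [star_fockMap_mul, one_mul, mul_one]
  right_inv x := by
    ext1
    change fockMap R h * (star (fockMap R h) * x * fockMap R h) * star (fockMap R h) = x
    calc _ = (fockMap R h * star (fockMap R h)) * x * (fockMap R h * star (fockMap R h)) := by
          simp only [mul_assoc]
      _ = x := by rw [fockMap_mul_star, one_mul, mul_one]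
  map_mul' x y := by
    ext1
    change fockMap R h * (x * y) * star (fockMap R h) =
      (fockMap R h * x * star (fockMap R h)) * (fockMap R h * y * star (fockMap R h))
    calc _ = fockMap R h * x * 1 * y * star (fockMap R h) := by simp only [mul_assoc, one_mul]
      _ = _ := by rw [← star_fockMap_mul h]; simp only [mul_assoc]
  map_add' x y := by
    ext1
    change fockMap R h * (x + y) * star (fockMap R h) =
      fockMap R h * x * star (fockMap R h) + fockMap R h * y * star (fockMap R h)
    rw [mul_add, add_mul]
  map_star' x := by
    ext1
    change fockMap R h * star (x : Fock Q →L[ℂ] Fock Q) * star (fockMap R h) =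
      star (fockMap R h * x * star (fockMap R h))
    rw [star_mul, star_mul, star_star, mul_assoc]
  map_smul' c x := by
    ext1
    change fockMap R h * (c • (x : Fock Q →L[ℂ] Fock Q)) * star (fockMap R h) =
      c • (fockMap R h * x * star (fockMap R h))
    rw [mul_smul_comm, smul_mul_assoc]

variable {Q} in
theorem secondQuant_star_mul {R : Matrix ι ι ℝ} (h : IsAdmissible Q R) (x y : GammaQ Q) :
    star (secondQuant R h x) * secondQuant R h y = secondQuant R h (star x * y) := by
  have h1 := (secondQuant R h).map_mul' (star x) y
  have h2 := (secondQuant R h).map_star' x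
  change secondQuant R h (star x * y) = secondQuant R h (star x) * secondQuant R h y at h1
  change secondQuant R h (star x) = star (secondQuant R h x) at h2
  rw [h1, h2]

variable {Q} in
theorem secondQuant_gen {R : Matrix ι ι ℝ} (h : IsAdmissible Q R) (j : ι) :
    secondQuant R h (gen Q j) = ∑ m, (R m j : ℂ) • gen Q m := by
  ext1
  simpa [gen] using! fockMap_gaussian h j

variable {Q} in
theorem tau_secondQuant {R : Matrix ι ι ℝ} (h : IsAdmissible Q R) (x : GammaQ Q) :
    tau Q (secondQuant R h x) = tau Q x := by
  have h1 : star (fockMap R h) (vacuum Q) = vacuum Q := by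
    rw [star_fockMap, fockMap_vacuum]
  change Inner.inner ℂ (vacuum Q) (fockMap R h ((x : Fock Q →L[ℂ] Fock Q)
    (star (fockMap R h) (vacuum Q)))) = _
  rw [h1, ← ContinuousLinearMap.adjoint_inner_left, ← ContinuousLinearMap.star_eq_adjoint, h1]
  rfl

/-- `Γ_Q` with the semi-inner product `⟨x, y⟩ = τ_Q(x^* y)`. -/
def PreL2 : Type _ := GammaQ Q
instance : AddCommGroup (PreL2 Q) := inferInstanceAs (AddCommGroup (GammaQ Q))
instance : Module ℂ (PreL2 Q) := inferInstanceAs (Module ℂ (GammaQ Q))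
/-- The identity map. -/
def toPreL2 : GammaQ Q ≃ₗ[ℂ] PreL2 Q := LinearEquiv.refl ℂ _

theorem tau_star_mul (x y : GammaQ Q) : tau Q (star x * y) =
    Inner.inner ℂ ((x : Fock Q →L[ℂ] Fock Q) (vacuum Q))
      ((y : Fock Q →L[ℂ] Fock Q) (vacuum Q)) := by
  change Inner.inner ℂ (vacuum Q) ((ContinuousLinearMap.adjoint (x : Fock Q →L[ℂ] Fock Q))
    ((y : Fock Q →L[ℂ] Fock Q) (vacuum Q))) = _
  rw [ContinuousLinearMap.adjoint_inner_right]

/-- The semi-inner product `⟨x, y⟩ = τ_Q(x^* y)`. -/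
abbrev preL2Core : PreInnerProductSpace.Core ℂ (PreL2 Q) where
  inner x y := tau Q (star ((toPreL2 Q).symm x) * (toPreL2 Q).symm y)
  conj_inner_symm x y := by
    rw [tau_star_mul, tau_star_mul]; exact inner_conj_symm _ _
  re_inner_nonneg x := by
    rw [tau_star_mul]; exact inner_self_nonneg (𝕜 := ℂ)
  add_left x y z := by
    rw [tau_star_mul, tau_star_mul, tau_star_mul, ← inner_add_left]; rfl
  smul_left x y c := by
    rw [tau_star_mul, tau_star_mul, ← inner_smul_left]; rfl

instance : SeminormedAddCommGroup (PreL2 Q) :=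
  InnerProductSpace.Core.toSeminormedAddCommGroup (c := preL2Core Q)
instance : InnerProductSpace ℂ (PreL2 Q) := InnerProductSpace.ofCore (preL2Core Q)

/-- `L_2(Γ_Q, τ_Q)`, the completion of `Γ_Q` for the norm `‖x‖_2 = τ_Q(x^* x)^{1/2}`. -/
abbrev L2 : Type _ := UniformSpace.Completion (PreL2 Q)

variable {Q} in
/-- The canonical map `Γ_Q → L_2(Γ_Q)`. -/
def toL2 (x : GammaQ Q) : L2 Q := (toPreL2 Q x : PreL2 Q)

theorem PreL2.inner_def (x y : GammaQ Q) :
    Inner.inner ℂ (toPreL2 Q x) (toPreL2 Q y) = tau Q (star x * y) := rfl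

variable {Q} in
/-- `Γ_Q(R)` as a linear map which is isometric for the norm `‖·‖_2`. -/
def preSecondQuant (R : Matrix ι ι ℝ) (h : IsAdmissible Q R) : PreL2 Q →ₗ[ℂ] PreL2 Q :=
  (toPreL2 Q).toLinearMap ∘ₗ (secondQuant R h).toAlgEquiv.toLinearMap ∘ₗ (toPreL2 Q).symm.toLinearMap

variable {Q} in
theorem preSecondQuant_norm {R : Matrix ι ι ℝ} (h : IsAdmissible Q R) (x : PreL2 Q) :
    ‖preSecondQuant R h x‖ = ‖x‖ := by
  obtain ⟨x, rfl⟩ := (toPreL2 Q).surjective x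
  have : preSecondQuant R h (toPreL2 Q x) = toPreL2 Q (secondQuant R h x) := rfl
  rw [this, @norm_eq_sqrt_re_inner ℂ, @norm_eq_sqrt_re_inner ℂ, PreL2.inner_def, PreL2.inner_def,
    secondQuant_star_mul, tau_secondQuant]

variable {Q} in
/-- The continuous extension of `Γ_Q(R)` to `L_2(Γ_Q)`. -/
def secondQuantL2 (R : Matrix ι ι ℝ) (h : IsAdmissible Q R) : L2 Q →L[ℂ] L2 Q :=
  ((preSecondQuant R h).mkContinuous 1 fun f => by rw [preSecondQuant_norm h, one_mul]).completion

variable {Q} in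
theorem secondQuantL2_toL2 {R : Matrix ι ι ℝ} (h : IsAdmissible Q R) (x : GammaQ Q) :
    secondQuantL2 R h (toL2 x) = toL2 (secondQuant R h x) :=
  ContinuousLinearMap.completion_apply_coe _ _

/-- The special Wick words `w(i)`, defined by `w(∅) = 1` and
`w(j ⊔ i) = s_j w(i) - ∑_l δ_{j, i_l} ∏_{r < l} q(i_r, i_l) w(i - i_l)`. -/
def wick : (s : ℕ) → (Fin s → ι) → GammaQ Q
  | 0, _ => 1
  | 1, i => gen Q (i 0)
  | s + 2, i => gen Q (i 0) * wick (s + 1) (Fin.tail i) - ∑ l : Fin (s + 1),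
      if i 0 = Fin.tail i l then
        ((∏ r : Fin (s + 1), if r < l then Q.mat (Fin.tail i r) (Fin.tail i l) else 1 : ℝ) : ℂ) •
          wick s (l.removeNth (Fin.tail i))
      else 0

/-- The vector `e_{i_1} ⊗ ⋯ ⊗ e_{i_n}` of the Fock space. -/
def wordVec {n : ℕ} (i : Fin n → ι) : Fock Q :=
  (PreFock.of Q n (Pi.single i 1) : PreFock Q)

theorem PreFock.inner_of_right (f : PreFock Q) (n : ℕ) (g : (Fin n → ι) → ℂ) :
    f.inner (PreFock.of Q n g) = levelInner Q (f.comp n) g := by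
  have h1 : f.inner (PreFock.of Q n g) = conj ((PreFock.of Q n g).inner f) :=
    ((preFockCore Q).conj_inner_symm f _).symm
  rw [h1, PreFock.inner_eq _ f (n + 1) fun m hm => PreFock.comp_of_ne Q (by omega) g,
    Finset.sum_eq_single n, PreFock.comp_of_self, levelInner_conj]
  · intro m _ hm
    rw [PreFock.comp_of_ne Q hm, levelInner_zero_left]
  · intro h
    exact absurd (Finset.mem_range.2 (Nat.lt_succ_self n)) h

theorem adjoint_creation_succ (j : ι) (n : ℕ) (g : (Fin (n + 1) → ι) → ℂ) :
    ContinuousLinearMap.adjoint (creation Q j) (PreFock.of Q (n + 1) g : PreFock Q) =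
      (PreFock.of Q n (levelAn Q j n g) : PreFock Q) := by
  refine ext_inner_left ℂ fun x => ?_
  induction x using UniformSpace.Completion.induction_on with
  | hp => exact isClosed_eq (by fun_prop) (by fun_prop)
  | ih f =>
    rw [ContinuousLinearMap.adjoint_inner_right, creation_coe, UniformSpace.Completion.inner_coe,
      UniformSpace.Completion.inner_coe, PreFock.inner_def, PreFock.inner_def,
      PreFock.inner_of_right, PreFock.inner_of_right, preCr_comp_succ, levelInner_cr]

theorem adjoint_creation_zero (j : ι) (g : (Fin 0 → ι) → ℂ) :
    ContinuousLinearMap.adjoint (creation Q j) (PreFock.of Q 0 g : PreFock Q) = 0 := by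
  refine ext_inner_left ℂ fun x => ?_
  induction x using UniformSpace.Completion.induction_on with
  | hp => exact isClosed_eq (by fun_prop) (by fun_prop)
  | ih f =>
    rw [ContinuousLinearMap.adjoint_inner_right, creation_coe, UniformSpace.Completion.inner_coe,
      PreFock.inner_def, PreFock.inner_of_right, preCr_comp_zero, levelInner_zero_left,
      inner_zero_right]

theorem creation_wordVec (j : ι) {n : ℕ} (i : Fin n → ι) :
    creation Q j (wordVec Q i) = wordVec Q (Fin.cons j i : Fin (n + 1) → ι) := by
  unfold wordVec
  rw [creation_coe, preCr_of]
  congr 2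
  ext k
  obtain ⟨a, w, rfl⟩ : ∃ a v, k = Fin.cons a v := ⟨k 0, Fin.tail k, (Fin.cons_self_tail k).symm⟩
  simp only [levelCr, LinearMap.coe_mk, AddHom.coe_mk, Fin.cons_zero, Fin.tail_cons,
    Pi.single_apply, Fin.cons_inj]
  split_ifs <;> simp_all

theorem annihilation_wordVec (j : ι) {n : ℕ} (i : Fin (n + 1) → ι) :
    ContinuousLinearMap.adjoint (creation Q j) (wordVec Q i) =
      ∑ l : Fin (n + 1), if j = i l then
        ((∏ r : Fin (n + 1), if r < l then Q.mat (i r) (i l) else 1 : ℝ) : ℂ) •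
          wordVec Q (l.removeNth i) else 0 := by
  unfold wordVec
  rw [adjoint_creation_succ]
  have h : levelAn Q j n (Pi.single i 1) = ∑ l : Fin (n + 1), if j = i l then
        ((∏ r : Fin (n + 1), if r < l then Q.mat (i r) (i l) else 1 : ℝ) : ℂ) •
          (Pi.single (l.removeNth i) 1 : (Fin n → ι) → ℂ) else 0 := by
    ext w
    simp only [levelAn, LinearMap.coe_mk, AddHom.coe_mk, Finset.sum_apply, Pi.single_apply,
      Fin.insertNth_eq_iff]
    refine Finset.sum_congr rfl fun l _ => ?_
    by_cases hj : j = i l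
    · by_cases hw : w = l.removeNth i
      · subst hw
        simp only [hj, and_self, if_true, mul_one, Pi.smul_apply, Pi.single_eq_same, smul_eq_mul]
        congr 1
        rw [Fin.prod_univ_succAbove _ l]
        simp only [lt_self_iff_false, if_false, one_mul]
        refine Finset.prod_congr rfl fun r _ => ?_
        simp only [Fin.succAbove_lt_iff_castSucc_lt, Fin.removeNth_apply]
        rw [Q.isSymm.apply]
      · simp [hw, hj]
    · simp [hj]
  rw [h, map_sum]
  have h2 := map_sum (UniformSpace.Completion.toComplₗᵢ (𝕜 := ℂ) (E := PreFock Q))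
    (fun l => PreFock.of Q n (if j = i l then
        ((∏ r : Fin (n + 1), if r < l then Q.mat (i r) (i l) else 1 : ℝ) : ℂ) •
          (Pi.single (l.removeNth i) 1 : (Fin n → ι) → ℂ) else 0)) Finset.univ
  refine h2.trans (Finset.sum_congr rfl fun l _ => ?_)
  change ((PreFock.of Q n _ : PreFock Q) : Fock Q) = _
  split_ifs
  · rw [map_smul, UniformSpace.Completion.coe_smul]
  · rw [map_zero, UniformSpace.Completion.coe_zero]

theorem wordVec_zero (i : Fin 0 → ι) : wordVec Q i = vacuum Q := by
  unfold wordVec vacuum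
  congr 2
  ext k
  simp [Subsingleton.elim k i]

/-- The identification of the Wick word `w(i)` with the tensor `e_{i_1} ⊗ ⋯ ⊗ e_{i_s}`. -/
theorem wick_vacuum : ∀ {s : ℕ} (i : Fin s → ι),
    (wick Q s i : Fock Q →L[ℂ] Fock Q) (vacuum Q) = wordVec Q i
  | 0, i => by rw [wordVec_zero]; rfl
  | 1, i => by
    change creation Q (i 0) (vacuum Q) +
      ContinuousLinearMap.adjoint (creation Q (i 0)) (vacuum Q) = _
    conv_lhs => enter [2]; unfold vacuum
    rw [adjoint_creation_zero, add_zero, ← wordVec_zero Q (Fin.tail i), creation_wordVec,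
      Fin.cons_self_tail]
  | s + 2, i => by
    have ih1 := wick_vacuum (Fin.tail i)
    have h : (wick Q (s + 2) i : Fock Q →L[ℂ] Fock Q) (vacuum Q) =
        gaussian Q (i 0) ((wick Q (s + 1) (Fin.tail i) : Fock Q →L[ℂ] Fock Q) (vacuum Q)) -
        ∑ l : Fin (s + 1), if i 0 = Fin.tail i l then
        ((∏ r : Fin (s + 1), if r < l then Q.mat (Fin.tail i r) (Fin.tail i l) else 1 : ℝ) : ℂ) •
          (wick Q s (l.removeNth (Fin.tail i)) : Fock Q →L[ℂ] Fock Q) (vacuum Q) else 0 := by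
      rw [wick, AddSubgroupClass.coe_sub, sub_apply, AddSubmonoidClass.coe_finsetSum, sum_apply]
      congr 1
      refine Finset.sum_congr rfl fun l _ => ?_
      split_ifs <;> rfl
    rw [h, ih1]
    have h3 : gaussian Q (i 0) (wordVec Q (Fin.tail i)) = wordVec Q i +
        ContinuousLinearMap.adjoint (creation Q (i 0)) (wordVec Q (Fin.tail i)) := by
      change creation Q (i 0) _ + ContinuousLinearMap.adjoint (creation Q (i 0)) _ = _
      rw [creation_wordVec, Fin.cons_self_tail]
    rw [h3, annihilation_wordVec, add_sub_assoc, sub_eq_zero.2, add_zero]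
    refine Finset.sum_congr rfl fun l _ => ?_
    rw [wick_vacuum (l.removeNth (Fin.tail i))]

end Algebra

section Deformation
open scoped NNReal
variable {ι : Type*} [Fintype ι] [DecidableEq ι] (Q : StructMatrix ι)

/-- The matrix `Q' = Q ⊗ (1 1; 1 1)`. The index set `[2N] = {1, …, N} ∪ {N + 1, …, 2N}` is
represented as a disjoint sum, `Sum.inr` giving the indices greater than `N`. -/
def StructMatrix.double : StructMatrix (ι ⊕ ι) where
  mat := Matrix.fromBlocks Q.mat Q.mat Q.mat Q.mat
  isSymm := Matrix.IsSymm.fromBlocks Q.isSymm Q.isSymm Q.isSymm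
  abs_lt_one i j := by
    rcases i with i | i <;> rcases j with j | j <;> exact Q.abs_lt_one i j

variable (ι) in
/-- The orthogonal transformation `R_t` of `ℝ^N ⊕ ℝ^N`, for `t ≥ 0`. -/
def rotation (t : ℝ≥0) : Matrix (ι ⊕ ι) (ι ⊕ ι) ℝ :=
  Matrix.fromBlocks (Real.exp (-t) • 1) (-(√(1 - Real.exp (-2 * t)) • 1))
    (√(1 - Real.exp (-2 * t)) • 1) (Real.exp (-t) • 1)

theorem rotation_admissible (t : ℝ≥0) : IsAdmissible Q.double (rotation ι t) where
  mul_transpose := by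
    have h1 : Real.exp (-(t : ℝ)) * Real.exp (-(t : ℝ)) = Real.exp (-2 * t) := by
      rw [← Real.exp_add]; ring_nf
    have h2 : √(1 - Real.exp (-2 * (t : ℝ))) * √(1 - Real.exp (-2 * (t : ℝ))) =
        1 - Real.exp (-2 * t) :=
      Real.mul_self_sqrt (by
        rw [sub_nonneg, Real.exp_le_one_iff]; nlinarith [t.coe_nonneg])
    unfold rotation
    rw [Matrix.fromBlocks_transpose, Matrix.fromBlocks_multiply, ← Matrix.fromBlocks_one]
    simp only [Matrix.transpose_neg, Matrix.transpose_smul, Matrix.transpose_one,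
      Matrix.mul_smul, Matrix.mul_one, smul_smul, Matrix.mul_neg,
      neg_neg, smul_neg, h1, h2, ← add_smul]
    congr 1
    · simp
    · simp [mul_comm]
    · simp [mul_comm]
    · simp
  compat i k hik j := by
    rcases i with i | i <;> rcases k with k | k <;> rcases j with j | j <;>
      (have : i = k := by
        by_contra hne
        exact hik (by simp [rotation, Matrix.one_apply_ne hne])
       subst this; rfl)

/-- The trace preserving automorphism `α_t = Γ(R_t)` of `Γ_{Q'}`. -/
def alpha (t : ℝ≥0) : GammaQ Q.double ≃⋆ₐ[ℂ] GammaQ Q.double :=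
  secondQuant (rotation ι t) (rotation_admissible Q t)

/-- The extension of `α_t` to an isometry of `L_2(Γ_{Q'})`; see `alphaL2_toL2`. -/
def alphaL2 (t : ℝ≥0) : L2 Q.double →L[ℂ] L2 Q.double :=
  secondQuantL2 (rotation ι t) (rotation_admissible Q t)

theorem alphaL2_toL2 (t : ℝ≥0) (x : GammaQ Q.double) :
    alphaL2 Q t (toL2 x) = toL2 (alpha Q t x) :=
  secondQuantL2_toL2 (rotation_admissible Q t) x

/-- The Wick word `w(i)` as a vector of `L_2`. -/
def wickL2 {s : ℕ} (i : Fin s → ι) : L2 Q := toL2 (wick Q s i)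

/-- The space `H^n ⊆ L_2(Γ_Q) ⊆ L_2(Γ_{Q'})`, spanned by the Wick words `w(i)`, `i ∈ [N]^n`. -/
def HLevel (n : ℕ) : Submodule ℂ (L2 Q.double) :=
  Submodule.span ℂ (Set.range fun i : Fin n → ι => wickL2 Q.double (Sum.inl ∘ i))

/-- The Hilbert space direct sum `⨁_{n ≥ k} H^n`. -/
def HTail (k : ℕ) : Submodule ℂ (L2 Q.double) :=
  (⨆ n ≥ k, HLevel Q n).topologicalClosure

/-- The subspace `L_2^0` of mean zero elements. -/
def L2Zero : Submodule ℂ (L2 Q) := (ℂ ∙ (toL2 (1 : GammaQ Q)))ᗮ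

/-- The closed subspace `F_m` of `L_2^0(Γ_{Q'})` spanned by the Wick words `w(i)` of positive length
with exactly `m` indices in `{N + 1, …, 2N}`. -/
def FSpace (m : ℕ) : Submodule ℂ (L2 Q.double) :=
  (Submodule.span ℂ {x | ∃ (s : ℕ) (i : Fin s → ι ⊕ ι), 1 ≤ s ∧
    (Finset.univ.filter fun r => (i r).isRight = true).card = m ∧
      x = wickL2 Q.double i}).topologicalClosure

/-- `E_m = ⨁_{k = 0}^m F_k` (the spaces `F_k` are closed and mutually orthogonal). -/
def ESpace (m : ℕ) : Submodule ℂ (L2 Q.double) := ⨆ k ≤ m, FSpace Q k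

/-- The orthogonal complement of `E_m` in `L_2^0(Γ_{Q'})`. -/
def EPerp (m : ℕ) : Submodule ℂ (L2 Q.double) := L2Zero Q.double ⊓ (ESpace Q m)ᗮ

theorem isClosed_EPerp (m : ℕ) : IsClosed (EPerp Q m : Set (L2 Q.double)) :=
  (Submodule.isClosed_orthogonal _).inter (Submodule.isClosed_orthogonal _)

instance (m : ℕ) : CompleteSpace (EPerp Q m) := (isClosed_EPerp Q m).completeSpace_coe

instance (m : ℕ) : (EPerp Q m).HasOrthogonalProjection :=
  Submodule.HasOrthogonalProjection.ofCompleteSpace _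

/-- The orthogonal projection `P_m` onto `E_m^⊥ ⊆ L_2^0(Γ_{Q'})`. -/
def projEPerp (m : ℕ) : L2 Q.double →L[ℂ] L2 Q.double := (EPerp Q m).starProjection

end Deformation

end MixedQ

end

open scoped NNReal
open MixedQ

/-! Sending `x` to `xΩ` identifies `L_2` isometrically with the Fock space, Wick words with
elementary tensors and `α_t` with the tensor powers of `R_t`. For a word in `[N]` of length `n`,
expanding `R_t e_j = e^{-t} e_j + √(1 - e^{-2t}) e_{j+N}` gives a sum over subsets `ε ⊆ [n]`, the
positions moved above `N`; its coefficient depends only on `|ε|`. Since `Q'` does not distinguish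
`j` from `j + N`, any tensor spread out with coefficients `w(|ε|)` has its squared norm multiplied
exactly by `∑_ε w(|ε|)^2` (`levelInner_levelWeight`). The norm comparison is thereby reduced to one
scalar inequality for each length, with no dependence on `N` or `Q`.

Put `p = 1 - e^{-2t}`. The squared coefficients of `α_t` form the law of `n` independent trials with
success probability `p`. As `P_{k-1}` keeps the words with at least `k` letters above `N`, the right
side carries the factor `P(Bin(n, p) ≥ k)` (`sum_rotWeight_sq`), while the left side carries `2(1 -
e^{-n t^k})` (`sum_rotWeight_sub_incl_sq`).

For `n ≥ k` the two factors are compared in `one_sub_exp_le_binomialTail`: cut the trials into `k`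
blocks of length `b = ⌊n/k⌋`. One success in each block already gives `k` successes, so the tail is
at least `(1 - e^{-2tb})^k`, which is of order `min(1, tb)^k`; and `n t^k` is at most `2k (tb)^k`,
because `n ≤ 2kb` and `b ≤ b^k`. Finite sums of the `H^n` are dense in the given space and both
sides are continuous, which finishes the proof (`norm_alphaL2_sub_le`). -/

noncomputable section

namespace MixedQ

open scoped ComplexConjugate NNReal

/-! ### Identification of tensors with Wick words in `L_2`. -/

section WickMap
variable {ι : Type*} [Fintype ι] [DecidableEq ι] (Q : StructMatrix ι)

theorem inner_toL2 (x y : GammaQ Q) : Inner.inner ℂ (toL2 x) (toL2 y) =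
    Inner.inner ℂ ((x : Fock Q →L[ℂ] Fock Q) (vacuum Q))
      ((y : Fock Q →L[ℂ] Fock Q) (vacuum Q)) := by
  unfold toL2
  rw [UniformSpace.Completion.inner_coe, PreL2.inner_def, tau_star_mul]

/-- The canonical map `Γ_Q → L_2(Γ_Q)`, as a linear map. -/
def toL2Lin : GammaQ Q →ₗ[ℂ] L2 Q :=
  (UniformSpace.Completion.toComplL (𝕜 := ℂ) (E := PreL2 Q)).toLinearMap ∘ₗ
    (toPreL2 Q).toLinearMap

theorem toL2Lin_apply (x : GammaQ Q) : toL2Lin Q x = toL2 x := rfl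

/-- An element of `L_2` coming from `Γ_Q` is determined by its action on the vacuum. -/
theorem toL2_eq_of_vacuum {x y : GammaQ Q} (h : (x : Fock Q →L[ℂ] Fock Q) (vacuum Q) =
    (y : Fock Q →L[ℂ] Fock Q) (vacuum Q)) : toL2 x = toL2 y := by
  -- The `L_2` norm of `x - y` is the Fock norm of `(x - y)Ω`, which vanishes.
  rw [← toL2Lin_apply, ← toL2Lin_apply, ← sub_eq_zero, ← map_sub, toL2Lin_apply,
    ← inner_self_eq_zero (𝕜 := ℂ), inner_toL2]
  have : ((x - y : GammaQ Q) : Fock Q →L[ℂ] Fock Q) (vacuum Q) = 0 := by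
    rw [AddSubgroupClass.coe_sub, sub_apply, h, sub_self]
  rw [this, inner_zero_left]

/-- The linear map sending `e_{i_1} ⊗ ⋯ ⊗ e_{i_n}` to the Wick word `w(i)`. -/
def wickMap : PreFock Q →ₗ[ℂ] GammaQ Q :=
  DFinsupp.lsum ℂ (M := fun n => (Fin n → ι) → ℂ)
    fun n => Fintype.linearCombination ℂ (wick Q n)

theorem wickMap_of (n : ℕ) (f : (Fin n → ι) → ℂ) :
    wickMap Q (PreFock.of Q n f) = ∑ i, f i • wick Q n i :=
  DFinsupp.lsum_single (M := fun n => (Fin n → ι) → ℂ) ℂ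
    (fun n => Fintype.linearCombination ℂ (wick Q n)) n f

/-- By linearity this reduces to basis tensors, where it is `wick_vacuum`. -/
theorem wickMap_vacuum (f : PreFock Q) :
    (wickMap Q f : Fock Q →L[ℂ] Fock Q) (vacuum Q) = (f : Fock Q) := by
  let S : PreFock Q →ₗ[ℂ] Fock Q := (ContinuousLinearMap.apply ℂ (Fock Q) (vacuum Q)).toLinearMap ∘ₗ
    (GammaQ Q).toSubalgebra.val.toLinearMap ∘ₗ wickMap Q
  let T : PreFock Q →ₗ[ℂ] Fock Q :=
    (UniformSpace.Completion.toComplL (𝕜 := ℂ) (E := PreFock Q)).toLinearMap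
  have h : S = T := PreFock.lin_ext fun n f => by
    have h1 : f = ∑ i, f i • (Pi.single i 1 : (Fin n → ι) → ℂ) := by
      ext j
      simp [Finset.sum_apply, Pi.single_apply]
    conv_rhs => rw [h1]
    simp only [map_sum, map_smul]
    change ((wickMap Q (PreFock.of Q n f) : GammaQ Q) : Fock Q →L[ℂ] Fock Q) (vacuum Q) =
      ∑ i, f i • wordVec Q i
    rw [wickMap_of, AddSubmonoidClass.coe_finsetSum, sum_apply]
    refine Finset.sum_congr rfl fun i _ => ?_
    rw [← wick_vacuum]
    rfl
  exact LinearMap.congr_fun h f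

/-- The isometric embedding of the algebraic Fock space into `L_2(Γ_Q)`. -/
def tensorL2 : PreFock Q →ₗ[ℂ] L2 Q := toL2Lin Q ∘ₗ wickMap Q

theorem tensorL2_of (n : ℕ) (f : (Fin n → ι) → ℂ) :
    tensorL2 Q (PreFock.of Q n f) = ∑ i, f i • wickL2 Q i := by
  unfold tensorL2
  rw [LinearMap.comp_apply, wickMap_of, map_sum]
  exact Finset.sum_congr rfl fun i _ => map_smul _ _ _

theorem tensorL2_single {n : ℕ} (i : Fin n → ι) :
    tensorL2 Q (PreFock.of Q n (Pi.single i 1)) = wickL2 Q i := by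
  rw [tensorL2_of, Finset.sum_eq_single i]
  · simp
  · intro j _ hj; simp [hj]
  · simp

/-- All `L_2` computations below are transported to the explicit form `levelInner` through this
isometry. -/
theorem inner_tensorL2 (f g : PreFock Q) :
    Inner.inner ℂ (tensorL2 Q f) (tensorL2 Q g) = f.inner g := by
  change Inner.inner ℂ (toL2 (wickMap Q f)) (toL2 (wickMap Q g)) = _
  rw [inner_toL2, wickMap_vacuum, wickMap_vacuum, UniformSpace.Completion.inner_coe,
    PreFock.inner_def]

theorem norm_tensorL2_sq (f : PreFock Q) : ‖tensorL2 Q f‖ ^ 2 = (f.inner f).re := by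
  rw [← inner_tensorL2]; exact norm_sq_eq_re_inner (𝕜 := ℂ) _

-- With `F = ⨁ R^{⊗ n}`, the operator `F x F^*` sends `Ω` to `F(xΩ)` because `F^*` fixes the vacuum,
-- and the action on `Ω` determines an element of `L_2`.
variable {Q} in
theorem secondQuantL2_tensorL2 {R : Matrix ι ι ℝ} (h : IsAdmissible Q R) (f : PreFock Q) :
    secondQuantL2 R h (tensorL2 Q f) = tensorL2 Q (preMap Q R f) := by
  change secondQuantL2 R h (toL2 (wickMap Q f)) = toL2 (wickMap Q (preMap Q R f))
  rw [secondQuantL2_toL2]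
  apply toL2_eq_of_vacuum
  change fockMap R h ((wickMap Q f : Fock Q →L[ℂ] Fock Q) (star (fockMap R h) (vacuum Q))) = _
  rw [star_fockMap, fockMap_vacuum, wickMap_vacuum, wickMap_vacuum, fockMap_coe]

/-- The inner product only pairs words that are rearrangements of each other. This is what makes
words with different numbers of letters above `N` orthogonal. -/
theorem levelInner_single_right {n : ℕ} (f : (Fin n → ι) → ℂ) (i : Fin n → ι)
    (hf : ∀ σ : Equiv.Perm (Fin n), f (i ∘ σ) = 0) : levelInner Q f (Pi.single i 1) = 0 := by
  unfold levelInner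
  refine Finset.sum_eq_zero fun j _ => Finset.sum_eq_zero fun σ _ => ?_
  by_cases h : j ∘ σ.symm = i
  · have : f j = 0 := by
      rw [← hf σ, ← h]; congr 1; ext; simp
    rw [this]; simp
  · rw [Pi.single_eq_of_ne h]; simp

end WickMap

/-! ### Tensors over `ℂ^{2N}` weighted by the number of letters above `N`. -/

section Weight
variable {ι : Type*}

/-- The number of letters greater than `N`. -/
def rightCount {n : ℕ} (i : Fin n → ι ⊕ ι) : ℕ :=
  (Finset.univ.filter fun r => (i r).isRight = true).card

/-- Reduction of the letters modulo `N`. -/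
def fold {n : ℕ} (i : Fin n → ι ⊕ ι) : Fin n → ι := fun r => Sum.elim id id (i r)

/-- The number of `true` entries. -/
def trueCount {n : ℕ} (ε : Fin n → Bool) : ℕ := (Finset.univ.filter fun r => ε r = true).card

theorem trueCount_cons {n : ℕ} (b : Bool) (ε : Fin n → Bool) :
    trueCount (Fin.cons b ε : Fin (n + 1) → Bool) = (if b then 1 else 0) + trueCount ε := by
  rw [trueCount, Finset.card_filter, Fin.sum_univ_succ, trueCount, Finset.card_filter]
  simp only [Fin.cons_zero, Fin.cons_succ]

theorem trueCount_le {n : ℕ} (ε : Fin n → Bool) : trueCount ε ≤ n := by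
  simpa [trueCount] using Finset.card_le_univ (Finset.univ.filter fun r => ε r = true)

theorem rightCount_comp {n : ℕ} (i : Fin n → ι ⊕ ι) (σ : Equiv.Perm (Fin n)) :
    rightCount (i ∘ σ) = rightCount i := by
  simp only [rightCount, Finset.card_filter, Function.comp_apply]
  exact Equiv.sum_comp σ fun r => if (i r).isRight = true then 1 else 0

/-- Words in `[2N]` as pairs of a word in `[N]` and the indicator of the letters above `N`. -/
def foldEquiv (ι : Type*) (n : ℕ) : (Fin n → ι ⊕ ι) ≃ (Fin n → ι) × (Fin n → Bool) where
  toFun i := (fold i, fun r => (i r).isRight)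
  invFun p r := if p.2 r then Sum.inr (p.1 r) else Sum.inl (p.1 r)
  left_inv i := by
    ext1 r; rcases h : i r with a | a <;> simp [fold, h]
  right_inv p := by
    ext r <;> rcases h : p.2 r <;> simp [fold, h]

theorem fold_foldEquiv_symm {n : ℕ} (p : (Fin n → ι) × (Fin n → Bool)) :
    fold ((foldEquiv ι n).symm p) = p.1 :=
  congrArg Prod.fst ((foldEquiv ι n).apply_symm_apply p)

theorem rightCount_foldEquiv_symm {n : ℕ} (p : (Fin n → ι) × (Fin n → Bool)) :
    rightCount ((foldEquiv ι n).symm p) = trueCount p.2 := by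
  have h := congrArg Prod.snd ((foldEquiv ι n).apply_symm_apply p)
  change (fun r => ((foldEquiv ι n).symm p r).isRight) = p.2 at h
  rw [← h]
  rfl

variable [Fintype ι] [DecidableEq ι] (Q : StructMatrix ι)

/-- The four blocks of `Q'` coincide, so crossings only see letters modulo `N`. -/
theorem crossWeight_double {n : ℕ} (i : Fin n → ι ⊕ ι) (σ : Equiv.Perm (Fin n)) :
    crossWeight Q.double i σ = crossWeight Q (fold i) σ := by
  have h : ∀ a b : ι ⊕ ι, Q.double.mat a b = Q.mat (Sum.elim id id a) (Sum.elim id id b) := by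
    rintro (a | a) (b | b) <;> rfl
  simp only [crossWeight, h, fold]

/-- Extension of a tensor over `ℂ^N` to one over `ℂ^{2N}`, the coordinate of a word depending on
the number of its letters above `N`. -/
def levelWeight (w : ℕ → ℝ) (n : ℕ) : ((Fin n → ι) → ℂ) →ₗ[ℂ] ((Fin n → ι ⊕ ι) → ℂ) where
  toFun f i := (w (rightCount i) : ℂ) * f (fold i)
  map_add' f g := by ext i; simp [mul_add]
  map_smul' r f := by ext i; simp [mul_left_comm]

theorem levelWeight_apply (w : ℕ → ℝ) {n : ℕ} (f : (Fin n → ι) → ℂ) (i : Fin n → ι ⊕ ι) :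
    levelWeight w n f i = (w (rightCount i) : ℂ) * f (fold i) := rfl

/-- A word over `[2N]` is a pair (word in `[N]`, pattern `ε`). A permutation acts on both, but it
preserves the number of letters above `N`, so both coordinates carry the same real weight `w(|ε|)`;
the crossing weight ignores `ε`. The sum therefore factors. -/
theorem levelInner_levelWeight (w : ℕ → ℝ) {n : ℕ} (f : (Fin n → ι) → ℂ) :
    levelInner Q.double (levelWeight w n f) (levelWeight w n f) =
      ((∑ ε : Fin n → Bool, w (trueCount ε) ^ 2 : ℝ) : ℂ) * levelInner Q f f := by
  unfold levelInner
  rw [← (foldEquiv ι n).symm.sum_comp, Fintype.sum_prod_type, Finset.mul_sum]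
  refine Finset.sum_congr rfl fun i _ => ?_
  rw [Complex.ofReal_sum, Finset.sum_mul]
  refine Finset.sum_congr rfl fun ε _ => ?_
  rw [Finset.mul_sum]
  refine Finset.sum_congr rfl fun σ _ => ?_
  have h : fold ((foldEquiv ι n).symm (i, ε) ∘ σ.symm) = i ∘ σ.symm := by
    exact congrArg (· ∘ σ.symm) (fold_foldEquiv_symm (i, ε))
  rw [levelWeight_apply, levelWeight_apply, rightCount_comp, rightCount_foldEquiv_symm,
    crossWeight_double, fold_foldEquiv_symm, h, map_mul, Complex.conj_ofReal]
  push_cast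
  ring

/-- `levelWeight` on the algebraic Fock space. -/
def weightMap (w : ℕ → ℕ → ℝ) : PreFock Q →ₗ[ℂ] PreFock Q.double :=
  DFinsupp.mapRange.linearMap (fun n => levelWeight (w n) n)

theorem weightMap_comp (w : ℕ → ℕ → ℝ) (f : PreFock Q) (n : ℕ) :
    (weightMap Q w f).comp n = levelWeight (w n) n (f.comp n) := rfl

theorem weightMap_of (w : ℕ → ℕ → ℝ) (n : ℕ) (f : (Fin n → ι) → ℂ) :
    weightMap Q w (PreFock.of Q n f) = PreFock.of Q.double n (levelWeight (w n) n f) := by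
  refine PreFock.ext fun m => ?_
  rw [weightMap_comp]
  by_cases h : m = n
  · subst h; rw [PreFock.comp_of_self, PreFock.comp_of_self]
  · rw [PreFock.comp_of_ne Q h, PreFock.comp_of_ne _ h, map_zero]

theorem weightMap_sub (w w' : ℕ → ℕ → ℝ) (f : PreFock Q) :
    weightMap Q w f - weightMap Q w' f = weightMap Q (w - w') f := by
  refine PreFock.ext fun n => ?_
  rw [map_sub]
  simp only [weightMap_comp]
  ext i
  simp [levelWeight_apply, sub_mul]

/-- Different lengths are orthogonal, so two weights can be compared length by length. -/
theorem norm_weightMap_sq (w : ℕ → ℕ → ℝ) (f : PreFock Q) (M : ℕ)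
    (hM : ∀ n, M ≤ n → f.comp n = 0) :
    ‖tensorL2 Q.double (weightMap Q w f)‖ ^ 2 = ∑ n ∈ Finset.range M,
      (∑ ε : Fin n → Bool, w n (trueCount ε) ^ 2) * (levelInner Q (f.comp n) (f.comp n)).re := by
  rw [norm_tensorL2_sq, PreFock.inner_eq _ _ M fun n hn => by
    rw [weightMap_comp, hM n hn, map_zero], Complex.re_sum]
  refine Finset.sum_congr rfl fun n _ => ?_
  rw [weightMap_comp, levelInner_levelWeight, Complex.re_ofReal_mul]

/-- The weight of the inclusion `Γ_Q ⊆ Γ_{Q'}`. -/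
def inclWeight : ℕ → ℕ → ℝ := fun _ m => if m = 0 then 1 else 0

/-- The weight of the rotation `R_t`. -/
def rotWeight (t : ℝ≥0) : ℕ → ℕ → ℝ := fun n m =>
  Real.exp (-t) ^ (n - m) * √(1 - Real.exp (-2 * t)) ^ m

theorem rightCount_eq_zero {n : ℕ} {i : Fin n → ι ⊕ ι} :
    rightCount i = 0 ↔ i = Sum.inl ∘ fold i := by
  simp only [rightCount, Finset.card_eq_zero, Finset.filter_eq_empty_iff, Finset.mem_univ,
    true_imp_iff, funext_iff, Function.comp_apply]
  refine forall_congr' fun r => ?_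
  rcases h : i r with a | a <;> simp [fold, h]

theorem fold_inl {n : ℕ} (k : Fin n → ι) : fold (Sum.inl ∘ k : Fin n → ι ⊕ ι) = k := rfl

theorem levelWeight_incl_single {n : ℕ} (k : Fin n → ι) :
    levelWeight (inclWeight n) n (Pi.single k 1) = Pi.single (Sum.inl ∘ k) 1 := by
  ext i
  rw [levelWeight_apply, inclWeight, Pi.single_apply, Pi.single_apply]
  by_cases h : i = Sum.inl ∘ k
  · subst h
    have : rightCount (Sum.inl ∘ k : Fin n → ι ⊕ ι) = 0 := rightCount_eq_zero.2 rfl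
    simp [this, fold_inl]
  · rw [if_neg h]
    by_cases h0 : rightCount i = 0
    · have h1 : fold i ≠ k := fun e => h (by rw [← e]; exact rightCount_eq_zero.1 h0)
      simp [h1]
    · simp [h0]

/-- Each letter kept below `N` contributes `e^{-t}` and each letter moved above contributes `√(1 -
e^{-2t})`. -/
theorem levelMap_rotation_incl (t : ℝ≥0) {n : ℕ} (f : (Fin n → ι) → ℂ) :
    levelMap (rotation ι t) n (levelWeight (inclWeight n) n f) =
      levelWeight (rotWeight t n) n f := by
  ext i
  have h1 : levelMap (rotation ι t) n (levelWeight (inclWeight n) n f) i = ∑ k : Fin n → ι ⊕ ι,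
    ((∏ r, rotation ι t (i r) (k r) : ℝ) : ℂ) * levelWeight (inclWeight n) n f k := rfl
  rw [h1, levelWeight_apply, Finset.sum_eq_single (Sum.inl ∘ fold i)]
  · have h0 : rightCount (Sum.inl ∘ fold i : Fin n → ι ⊕ ι) = 0 := rightCount_eq_zero.2 rfl
    rw [levelWeight_apply, fold_inl, inclWeight, if_pos h0]
    have h2 : ∀ r, rotation ι t (i r) ((Sum.inl ∘ fold i : Fin n → ι ⊕ ι) r) =
        if (i r).isRight = true then √(1 - Real.exp (-2 * t)) else Real.exp (-t) := by
      intro r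
      rcases h : i r with a | a <;> simp [fold, h, rotation]
    have h3 : (Finset.univ.filter fun r => ¬ (i r).isRight = true).card = n - rightCount i := by
      rw [Finset.filter_not, Finset.card_sdiff_of_subset (Finset.filter_subset _ _)]
      simp [rightCount]
    rw [Finset.prod_congr rfl fun r _ => h2 r, Finset.prod_ite, Finset.prod_const,
      Finset.prod_const, h3]
    simp [rotWeight, rightCount, mul_comm]
  -- Another source word contributes nothing: either it has a letter above `N` and the inclusion
  -- weight vanishes, or it differs from `fold i` at some position, where the scalar blocks of the
  -- rotation have entry zero.
  · intro k _ hk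
    rw [levelWeight_apply]
    by_cases h0 : rightCount k = 0
    · rw [rightCount_eq_zero.1 h0] at hk ⊢
      obtain ⟨r, hr⟩ := Function.ne_iff.1 (fun e : fold k = fold i => hk (by rw [e]))
      have : ∏ r, rotation ι t (i r) ((Sum.inl ∘ fold k : Fin n → ι ⊕ ι) r) = 0 := by
        refine Finset.prod_eq_zero (Finset.mem_univ r) ?_
        rcases h : i r with a | a
        · have : a ≠ fold k r := fun e => hr (by rw [← e]; simp [fold, h])
          simp [rotation, this]
        · have : a ≠ fold k r := fun e => hr (by rw [← e]; simp [fold, h])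
          simp [rotation, this]
      rw [this]; simp
    · simp [inclWeight, h0]
  · simp

theorem alphaL2_incl (t : ℝ≥0) (f : PreFock Q) :
    alphaL2 Q t (tensorL2 Q.double (weightMap Q inclWeight f)) =
      tensorL2 Q.double (weightMap Q (rotWeight t) f) := by
  unfold alphaL2
  rw [secondQuantL2_tensorL2]
  congr 1
  refine PreFock.ext fun n => ?_
  rw [preMap_comp, weightMap_comp, weightMap_comp, levelMap_rotation_incl]

end Weight

/-! ### Tail probabilities of the binomial law. -/

section BinomialTail

/-- The probability of at least `k` successes in `n` independent trials with success probability
`p`. -/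
def binomialTail (p : ℝ) : ℕ → ℕ → ℝ
  | _, 0 => 1
  | 0, _ + 1 => 0
  | n + 1, k + 1 => p * binomialTail p n k + (1 - p) * binomialTail p n (k + 1)

variable {p : ℝ}

theorem binomialTail_zero (p : ℝ) (n : ℕ) : binomialTail p n 0 = 1 := by
  cases n <;> rfl

theorem binomialTail_nonneg (h0 : 0 ≤ p) (h1 : p ≤ 1) : ∀ n k, 0 ≤ binomialTail p n k
  | 0, 0 => zero_le_one
  | _ + 1, 0 => zero_le_one
  | 0, _ + 1 => le_rfl
  | n + 1, k + 1 => add_nonneg (mul_nonneg h0 (binomialTail_nonneg h0 h1 n k))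
      (mul_nonneg (sub_nonneg.2 h1) (binomialTail_nonneg h0 h1 n (k + 1)))

theorem binomialTail_succ_le (h0 : 0 ≤ p) (h1 : p ≤ 1) :
    ∀ n k, binomialTail p n (k + 1) ≤ binomialTail p n k
  | 0, 0 => zero_le_one
  | 0, _ + 1 => le_rfl
  | n + 1, 0 => by
    have h := binomialTail_succ_le h0 h1 n 0
    rw [binomialTail_zero] at h
    rw [binomialTail_zero, binomialTail, binomialTail_zero]
    nlinarith
  | n + 1, k + 1 => add_le_add (mul_le_mul_of_nonneg_left (binomialTail_succ_le h0 h1 n k) h0)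
      (mul_le_mul_of_nonneg_left (binomialTail_succ_le h0 h1 n (k + 1)) (sub_nonneg.2 h1))

/-- An additional trial changes the tail at `k + 1` by `p` times the difference of the tails at `k`
and `k + 1`, which is nonnegative. -/
theorem binomialTail_mono (h0 : 0 ≤ p) (h1 : p ≤ 1) (k : ℕ) :
    Monotone fun n => binomialTail p n k := by
  refine monotone_nat_of_le_succ fun n => ?_
  rcases k with _ | k
  · rw [binomialTail_zero, binomialTail_zero]
  · have := mul_le_mul_of_nonneg_left (binomialTail_succ_le h0 h1 n k) h0
    rw [binomialTail]
    linarith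

/-- Having `k` successes in the first `a` trials and at least one in the next `b` is enough for `k +
1` successes in all. The induction on `b` conditions on the last trial. -/
theorem binomialTail_add (h0 : 0 ≤ p) (h1 : p ≤ 1) (a k b : ℕ) :
    binomialTail p a k * (1 - (1 - p) ^ b) ≤ binomialTail p (a + b) (k + 1) := by
  induction b with
  | zero => simpa using binomialTail_nonneg h0 h1 a (k + 1)
  | succ b ih =>
    have h2 := mul_le_mul_of_nonneg_left ih (sub_nonneg.2 h1)
    have h3 := mul_le_mul_of_nonneg_left (binomialTail_mono h0 h1 k (Nat.le_add_right a b)) h0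
    rw [← add_assoc, binomialTail, pow_succ]
    linarith

/-- The event considered is one success in each of `k` disjoint blocks of length `b`. -/
theorem pow_le_binomialTail (h0 : 0 ≤ p) (h1 : p ≤ 1) (b k : ℕ) :
    (1 - (1 - p) ^ b) ^ k ≤ binomialTail p (k * b) k := by
  induction k with
  | zero => simp [binomialTail_zero]
  | succ k ih =>
    have h2 : 0 ≤ 1 - (1 - p) ^ b := by
      linarith [pow_le_one₀ (n := b) (sub_nonneg.2 h1) (by linarith)]
    rw [pow_succ, Nat.succ_mul]
    exact (mul_le_mul_of_nonneg_right ih h2).trans (binomialTail_add h0 h1 _ _ _)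

/-! ### Coefficients of the rotation as binomial probabilities. -/

theorem sum_trueCount_succ (n : ℕ) (g : ℕ → ℝ) :
    ∑ ε : Fin (n + 1) → Bool, g (trueCount ε) =
      ∑ ε : Fin n → Bool, g (trueCount ε + 1) + ∑ ε : Fin n → Bool, g (trueCount ε) := by
  rw [← (Fin.consEquiv (fun _ => Bool)).sum_comp, Fintype.sum_prod_type, Fintype.sum_bool]
  simp only [Fin.consEquiv, Equiv.coe_fn_mk, trueCount_cons, if_true, Bool.false_eq_true, if_false,
    zero_add, add_comm 1]

theorem sum_trueCount_eq_zero (n : ℕ) :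
    ∑ ε : Fin n → Bool, (if trueCount ε = 0 then (1 : ℝ) else 0) = 1 := by
  induction n with
  | zero => simp [trueCount]
  | succ n ih =>
    rw [sum_trueCount_succ n fun m => if m = 0 then (1 : ℝ) else 0, ih]
    simp

theorem one_sub_exp_nonneg (t : ℝ≥0) : 0 ≤ 1 - Real.exp (-2 * t) := by
  rw [sub_nonneg, Real.exp_le_one_iff]; nlinarith [t.coe_nonneg]

theorem rotWeight_succ_succ_sq (t : ℝ≥0) (n m : ℕ) :
    rotWeight t (n + 1) (m + 1) ^ 2 = (1 - Real.exp (-2 * t)) * rotWeight t n m ^ 2 := by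
  unfold rotWeight
  rw [Nat.add_sub_add_right, pow_succ √_]
  simp only [mul_pow]
  rw [Real.sq_sqrt (one_sub_exp_nonneg t)]
  ring

theorem rotWeight_succ_sq (t : ℝ≥0) {n m : ℕ} (h : m ≤ n) :
    rotWeight t (n + 1) m ^ 2 = Real.exp (-2 * t) * rotWeight t n m ^ 2 := by
  unfold rotWeight
  have h2 : Real.exp (-2 * t) = Real.exp (-t) ^ 2 := by
    rw [← Real.exp_nat_mul]; push_cast; ring_nf
  rw [Nat.succ_sub h, pow_succ (Real.exp _) (n - m), h2]
  ring

/-- Splitting a pattern by its first entry reproduces the recursion of `binomialTail`: a `true` has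
squared weight `1 - e^{-2t}` and lowers the threshold by one, a `false` has squared weight
`e^{-2t}`. -/
theorem sum_rotWeight_sq (t : ℝ≥0) : ∀ n k : ℕ,
    ∑ ε : Fin n → Bool, (if k ≤ trueCount ε then rotWeight t n (trueCount ε) else 0) ^ 2 =
      binomialTail (1 - Real.exp (-2 * t)) n k := by
  intro n
  induction n with
  | zero =>
    rintro (_ | k)
    · simp [trueCount, rotWeight, binomialTail]
    · simp [trueCount, binomialTail]
  | succ n ih =>
    intro k
    rw [sum_trueCount_succ n fun m => (if k ≤ m then rotWeight t (n + 1) m else 0) ^ 2]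
    have h1 : ∑ ε : Fin n → Bool,
        (if k ≤ trueCount ε then rotWeight t (n + 1) (trueCount ε) else 0) ^ 2 =
        Real.exp (-2 * t) * binomialTail (1 - Real.exp (-2 * t)) n k := by
      rw [← ih k, Finset.mul_sum]
      refine Finset.sum_congr rfl fun ε _ => ?_
      split_ifs
      · exact rotWeight_succ_sq t (trueCount_le ε)
      · simp
    have h2 : ∑ ε : Fin n → Bool,
        (if k ≤ trueCount ε + 1 then rotWeight t (n + 1) (trueCount ε + 1) else 0) ^ 2 =
        (1 - Real.exp (-2 * t)) * binomialTail (1 - Real.exp (-2 * t)) n (k - 1) := by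
      rw [← ih (k - 1), Finset.mul_sum]
      refine Finset.sum_congr rfl fun ε _ => ?_
      simp only [Nat.sub_le_iff_le_add]
      split_ifs
      · exact rotWeight_succ_succ_sq t _ _
      · simp
    rw [h1, h2]
    -- For threshold `0` the truncated `k - 1` is again `0`; both tails equal `1` and the two
    -- probabilities add up to `1`.
    rcases k with _ | k
    · simp [binomialTail_zero]
    · simp [binomialTail]

/-- The rotation weights have total squared mass `1`, the inclusion lives on the empty pattern
alone, and the two overlap there with coefficient `e^{-nt}`; hence `1 + 1 - 2e^{-nt}`. -/
theorem sum_rotWeight_sub_incl_sq (t : ℝ≥0) (n : ℕ) :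
    ∑ ε : Fin n → Bool, (rotWeight t - inclWeight) n (trueCount ε) ^ 2 =
      2 * (1 - Real.exp (-(n * t))) := by
  have h1 := sum_rotWeight_sq t n 0
  simp only [zero_le, if_true, binomialTail_zero] at h1
  -- On the empty pattern, `(c - 1)^2 = c^2 + (1 - 2c)` with `c = e^{-nt}`.
  have h2 : ∀ m, (rotWeight t - inclWeight) n m ^ 2 = rotWeight t n m ^ 2 +
      (1 - 2 * Real.exp (-(n * t))) * (if m = 0 then 1 else 0) := by
    intro m
    rw [Pi.sub_apply, Pi.sub_apply, inclWeight]
    split_ifs with h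
    · have : rotWeight t n m = Real.exp (-(n * t)) := by
        rw [h, rotWeight, pow_zero, mul_one, Nat.sub_zero, ← Real.exp_nat_mul]
        ring_nf
      rw [this]; ring
    · simp
  simp only [h2]
  rw [Finset.sum_add_distrib, h1, ← Finset.mul_sum, sum_trueCount_eq_zero]
  ring

/-! ### The scalar inequality for a fixed length. -/

theorem le_one_sub_exp_neg {x : ℝ} (hx : 0 ≤ x) : x / (1 + x) ≤ 1 - Real.exp (-x) := by
  rw [Real.exp_neg, le_sub_comm]
  have h : 1 - x / (1 + x) = (1 + x)⁻¹ := by field_simp; ring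
  rw [h]
  exact inv_anti₀ (by linarith) (by linarith [Real.add_one_le_exp x])

/-- The block bound is compared with `n t^k` according to whether `tb` is large or small, where `b =
⌊n/k⌋`. The factor `2^k` in the constant serves the first regime, and `4k` comes from `2n ≤ 4kb` in
the second. -/
theorem one_sub_exp_le_binomialTail (t : ℝ≥0) {n k : ℕ} (hk : 1 ≤ k) (hn : k ≤ n) :
    2 * (1 - Real.exp (-(n * t ^ k))) ≤
      4 * k * 2 ^ k * binomialTail (1 - Real.exp (-2 * t)) n k := by
  set b := n / k
  have hb : 1 ≤ b := (Nat.one_le_div_iff (by omega)).2 hn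
  -- Rounding down loses at most a factor `2`, because `b ≥ 1`.
  have hn2 : n ≤ 2 * k * b := by
    have : n < k * (b + 1) := Nat.lt_mul_div_succ n (by omega)
    nlinarith
  have hb' : (1 : ℝ) ≤ b := by exact_mod_cast hb
  have hk' : (1 : ℝ) ≤ k := by exact_mod_cast hk
  have ht := t.coe_nonneg
  have hp0 := one_sub_exp_nonneg t
  have hp1 : 1 - Real.exp (-2 * t) ≤ 1 := by linarith [Real.exp_pos (-2 * t)]
  -- Only `k * b ≤ n` trials are used by the blocks; the others can only increase the tail. The
  -- failure probability of a block is `(e^{-2t})^b`.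
  have h1 : (1 - Real.exp (-(2 * (t * b)))) ^ k ≤ binomialTail (1 - Real.exp (-2 * t)) n k := by
    have h := (pow_le_binomialTail hp0 hp1 b k).trans
      (binomialTail_mono hp0 hp1 k (Nat.mul_div_le n k))
    have he : (b : ℝ) * (-2 * t) = -(2 * (t * b)) := by ring
    rwa [sub_sub_cancel, ← Real.exp_nat_mul, he] at h
  have h2 := le_one_sub_exp_neg (x := 2 * (t * b)) (by positivity)
  refine le_trans ?_ (mul_le_mul_of_nonneg_left h1 (by positivity))
  -- If `tb ≥ 1/2`, each block succeeds with probability at least `1/2`, so the right side is at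
  -- least `4k`, whereas the left side is below `2`.
  rcases le_total (1 / 2 : ℝ) (t * b) with hu | hu
  · have h3 : (1 / 2 : ℝ) ≤ 1 - Real.exp (-(2 * (t * b))) := by
      refine le_trans ?_ h2
      rw [div_le_div_iff₀ (by norm_num) (by positivity)]
      linarith
    have h4 := pow_le_pow_left₀ (by norm_num) h3 k
    have h5 : 4 * k * 2 ^ k * (1 / 2 : ℝ) ^ k = 4 * k := by
      rw [mul_assoc, ← mul_pow]; norm_num
    have h6 := mul_le_mul_of_nonneg_left h4 (by positivity : (0 : ℝ) ≤ 4 * k * 2 ^ k)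
    have := Real.exp_pos (-(n * t ^ k : ℝ))
    linarith
  -- If `tb ≤ 1/2`, then `2tb/(1 + 2tb) ≥ tb`, so a block succeeds with probability at least `tb`;
  -- the left side is linearized by `1 - e^{-y} ≤ y`.
  · have h3 : (t * b : ℝ) ≤ 1 - Real.exp (-(2 * (t * b))) := by
      refine le_trans ?_ h2
      rw [le_div_iff₀ (by positivity)]
      nlinarith [mul_nonneg ht (by linarith : (0 : ℝ) ≤ b)]
    have h4 := pow_le_pow_left₀ (by positivity) h3 k
    have h5 : (b : ℝ) ≤ b ^ k := le_self_pow₀ hb' (by omega)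
    have h6 : (1 : ℝ) ≤ 2 ^ k := one_le_pow₀ (by norm_num)
    have h7 := Real.add_one_le_exp (-(n * t ^ k : ℝ))
    have h8 : (n : ℝ) ≤ 2 * k * b := by exact_mod_cast hn2
    calc 2 * (1 - Real.exp (-(n * t ^ k))) ≤ 2 * (n * t ^ k) := by linarith
      _ ≤ 2 * (2 * k * b * t ^ k) := by gcongr
      _ ≤ 2 * (2 * k * b ^ k * t ^ k) := by gcongr
      _ = 4 * k * 1 * (t * b) ^ k := by rw [mul_pow]; ring
      _ ≤ 4 * k * 2 ^ k * (1 - Real.exp (-(2 * (t * b)))) ^ k := by gcongr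

end BinomialTail

/-! ### The projections `P_m`, and passage to the closure. -/

section Projection
variable {ι : Type*} [Fintype ι] [DecidableEq ι] (Q : StructMatrix ι)

/-- Decomposition of an element of the algebraic Fock space into its components. -/
theorem PreFock.eq_sum_of (f : PreFock Q) (M : ℕ) (hM : ∀ n, M ≤ n → f.comp n = 0) :
    f = ∑ n ∈ Finset.range M, PreFock.of Q n (f.comp n) := by
  refine PreFock.ext fun m => ?_
  rw [map_sum]
  by_cases h : m < M
  · rw [Finset.sum_eq_single m, PreFock.comp_of_self]
    · intro n _ hn; exact PreFock.comp_of_ne Q hn.symm _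
    · intro hm; exact absurd (Finset.mem_range.2 h) hm
  · rw [hM m (by omega), Finset.sum_eq_zero]
    intro n hn
    exact PreFock.comp_of_ne Q (by have := Finset.mem_range.1 hn; omega) _

theorem wickL2_mem_ESpace {m s : ℕ} (i : Fin s → ι ⊕ ι) (hs : 1 ≤ s) (hi : rightCount i ≤ m) :
    wickL2 Q.double i ∈ ESpace Q m := by
  have h : wickL2 Q.double i ∈ FSpace Q (rightCount i) :=
    Submodule.le_topologicalClosure _ (Submodule.subset_span ⟨s, i, hs, rfl, rfl⟩)
  exact Submodule.mem_iSup_of_mem _ (Submodule.mem_iSup_of_mem hi h)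

/-- Tensors of positive length supported on words with at most `m` letters above `N`
belong to `E_m`. -/
theorem tensorL2_weightMap_mem_ESpace {m : ℕ} {w : ℕ → ℕ → ℝ} (hw : ∀ n r, m < r → w n r = 0)
    (f : PreFock Q) (hf : f.comp 0 = 0) :
    tensorL2 Q.double (weightMap Q w f) ∈ ESpace Q m := by
  obtain ⟨M, hM⟩ := f.exists_bound
  rw [PreFock.eq_sum_of Q f M hM, map_sum, map_sum]
  refine Submodule.sum_mem _ fun n _ => ?_
  rcases Nat.eq_zero_or_pos n with rfl | hn
  -- The empty word is excluded from `E_m`, hence the assumption that the component of length zero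
  -- vanishes.
  · rw [hf]; simp
  rw [weightMap_of, tensorL2_of]
  refine Submodule.sum_mem _ fun i _ => ?_
  by_cases hi : rightCount i ≤ m
  · exact Submodule.smul_mem _ _ (wickL2_mem_ESpace Q i hn hi)
  · rw [levelWeight_apply, hw n _ (by omega)]
    simp

theorem inner_wickL2_weightMap {m : ℕ} {w : ℕ → ℕ → ℝ} (hw : ∀ n r, r ≤ m → w n r = 0)
    (f : PreFock Q) {s : ℕ} (i : Fin s → ι ⊕ ι) (hi : rightCount i ≤ m) :
    Inner.inner ℂ (tensorL2 Q.double (weightMap Q w f)) (wickL2 Q.double i) = 0 := by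
  rw [← tensorL2_single, inner_tensorL2, PreFock.inner_of_right, levelInner_single_right]
  intro σ
  rw [weightMap_comp, levelWeight_apply, rightCount_comp, hw s _ hi]
  simp

/-- Tensors supported on words with more than `m` letters above `N` belong to `E_m^⊥`. -/
theorem tensorL2_weightMap_mem_EPerp {m : ℕ} {w : ℕ → ℕ → ℝ} (hw : ∀ n r, r ≤ m → w n r = 0)
    (f : PreFock Q) : tensorL2 Q.double (weightMap Q w f) ∈ EPerp Q m := by
  refine ⟨?_, ?_⟩
  · unfold L2Zero
    refine Submodule.mem_orthogonal_singleton_iff_inner_left.2 ?_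
    -- The unit is the Wick word of the empty word, which has no letter above `N`; mean zero is thus
    -- another instance of the same orthogonality.
    exact inner_wickL2_weightMap Q hw f (Fin.elim0 : Fin 0 → ι ⊕ ι) (by simp [rightCount])
  · have h : ESpace Q m ≤ (ℂ ∙ tensorL2 Q.double (weightMap Q w f))ᗮ := by
      -- Orthogonality to a vector is a closed condition, so the generating Wick words suffice.
      refine iSup₂_le fun r hr => Submodule.topologicalClosure_minimal _ (Submodule.span_le.2 ?_)
        (Submodule.isClosed_orthogonal _)
      rintro _ ⟨s, i, _, hi, rfl⟩
      rw [SetLike.mem_coe, Submodule.mem_orthogonal_singleton_iff_inner_right]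
      exact inner_wickL2_weightMap Q hw f i (hi.le.trans hr)
    refine (Submodule.mem_orthogonal' _ _).2 fun y hy => ?_
    exact Submodule.mem_orthogonal_singleton_iff_inner_right.1 (h hy)

/-- `P_m` kills the coordinates of the words with at most `m` letters above `N`. -/
theorem projEPerp_tensorL2_weightMap (m : ℕ) (w : ℕ → ℕ → ℝ) (f : PreFock Q)
    (hf : f.comp 0 = 0) :
    projEPerp Q m (tensorL2 Q.double (weightMap Q w f)) =
      tensorL2 Q.double (weightMap Q (fun n r => if m < r then w n r else 0) f) := by
  unfold projEPerp
  apply Submodule.eq_starProjection_of_mem_orthogonal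
  · exact tensorL2_weightMap_mem_EPerp Q (fun n r hr => if_neg hr.not_gt) f
  rw [← map_sub, weightMap_sub]
  -- The discarded part lies in `E_m`, hence is orthogonal to `E_m^⊥` and to its subspace `EPerp`.
  have h := tensorL2_weightMap_mem_ESpace Q (m := m)
    (w := w - fun n r => if m < r then w n r else 0) (fun n r hr => by simp [hr]) f hf
  exact Submodule.orthogonal_le (inf_le_right : EPerp Q m ≤ _)
    (Submodule.le_orthogonal_orthogonal _ h)

/-- Before closure the sum of the `H^n` is algebraic, so its elements come from genuine tensors
without components of length below `k`, to which the coordinate formulas apply. -/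
theorem exists_tensorL2_of_mem_iSup_HLevel (k : ℕ) {x : L2 Q.double}
    (hx : x ∈ ⨆ n ≥ k, HLevel Q n) : ∃ f : PreFock Q, (∀ n < k, f.comp n = 0) ∧
      tensorL2 Q.double (weightMap Q inclWeight f) = x := by
  let K : Submodule ℂ (PreFock Q) := ⨅ n, ⨅ (_ : n < k), LinearMap.ker (PreFock.comp n)
  have h : (⨆ n ≥ k, HLevel Q n) ≤ K.map (tensorL2 Q.double ∘ₗ weightMap Q inclWeight) := by
    refine iSup₂_le fun n hn => Submodule.span_le.2 ?_
    rintro _ ⟨i, rfl⟩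
    refine ⟨PreFock.of Q n (Pi.single i 1), ?_, ?_⟩
    · simp only [K, SetLike.mem_coe, Submodule.mem_iInf, LinearMap.mem_ker]
      exact fun m hm => PreFock.comp_of_ne Q (by omega) _
    · rw [LinearMap.comp_apply, weightMap_of, levelWeight_incl_single, tensorL2_single]
  obtain ⟨f, hf, hfx⟩ := h hx
  simp only [K, SetLike.mem_coe, Submodule.mem_iInf, LinearMap.mem_ker] at hf
  exact ⟨f, hf, hfx⟩

theorem norm_alphaL2_sub_le (k : ℕ) (hk : 1 ≤ k) (t : ℝ≥0) {x : L2 Q.double}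
    (hx : x ∈ HTail Q k) : ‖alphaL2 Q (t ^ k) x - x‖ ≤
      4 * k * 2 ^ k * ‖projEPerp Q (k - 1) (alphaL2 Q t x)‖ := by
  have hcl : IsClosed {x : L2 Q.double | ‖alphaL2 Q (t ^ k) x - x‖ ≤
      4 * k * 2 ^ k * ‖projEPerp Q (k - 1) (alphaL2 Q t x)‖} :=
    isClosed_le (by fun_prop) (by fun_prop)
  -- It suffices to treat the dense algebraic sum.
  refine closure_minimal (fun x hx => ?_) hcl hx
  obtain ⟨f, hf, rfl⟩ := exists_tensorL2_of_mem_iSup_HLevel Q k hx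
  obtain ⟨M, hM⟩ := f.exists_bound
  have hk' : (1 : ℝ) ≤ k := by exact_mod_cast hk
  have hC : (1 : ℝ) ≤ 4 * k * 2 ^ k := by
    nlinarith [one_le_pow₀ (by norm_num : (1 : ℝ) ≤ 2) (n := k)]
  rw [Set.mem_ofPred_eq, alphaL2_incl, alphaL2_incl, ← map_sub, weightMap_sub,
    projEPerp_tensorL2_weightMap Q _ _ f (hf 0 hk), ← sq_le_sq₀ (norm_nonneg _) (by positivity),
    mul_pow, norm_weightMap_sq Q _ f M hM, norm_weightMap_sq Q _ f M hM]
  -- After squaring the constant appears as `C^2`, while the scalar inequality only needs `C`; since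
  -- `C ≥ 1`, the square may be weakened to `C`.
  refine le_trans ?_ (mul_le_mul_of_nonneg_right (le_self_pow₀ hC two_ne_zero)
    (Finset.sum_nonneg fun n _ => mul_nonneg (Finset.sum_nonneg fun _ _ => sq_nonneg _)
      (levelInner_self_nonneg Q _)))
  rw [Finset.mul_sum]
  refine Finset.sum_le_sum fun n _ => ?_
  by_cases hn : n < k
  · rw [hf n hn, levelInner_zero_left]; simp
  -- Surviving `P_{k-1}` means having at least `k` letters above `N`; the truncated subtraction is
  -- harmless since `k ≥ 1`.
  · have h1 : ∀ m, (if k - 1 < m then rotWeight t n m else 0) =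
        if k ≤ m then rotWeight t n m else 0 := fun m => by
      simp only [Nat.sub_lt_iff_lt_add hk, Nat.lt_add_one_iff]
    simp only [h1]
    rw [sum_rotWeight_sq, sum_rotWeight_sub_incl_sq, ← mul_assoc]
    refine mul_le_mul_of_nonneg_right ?_ (levelInner_self_nonneg Q _)
    simpa using one_sub_exp_le_binomialTail t hk (not_lt.1 hn)

end Projection

end MixedQ

end

open scoped NNReal
open MixedQ
theorem mainTheorem11 (k : ℕ) (hk : 1 ≤ k) :
    ∃ C : ℝ, 0 < C ∧
      ∀ (N : ℕ) (A : Matrix (Fin N) (Fin N) ℝ) (hsymm : A.IsSymm) (hlt : ∀ i j, |A i j| < 1)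
        (t : ℝ≥0), (t : ℝ) < (2 : ℝ) ^ (-(k : ℤ)) →
        ∀ x ∈ HTail ⟨A, hsymm, hlt⟩ k,
          ‖alphaL2 ⟨A, hsymm, hlt⟩ (t ^ k) x - x‖ ≤
            C * ‖projEPerp ⟨A, hsymm, hlt⟩ (k - 1) (alphaL2 ⟨A, hsymm, hlt⟩ t x)‖ := by
  have hk' : (0 : ℝ) < k := by exact_mod_cast hk
  exact ⟨4 * k * 2 ^ k, by positivity, fun N A hsymm hlt t _ x hx =>
    norm_alphaL2_sub_le ⟨A, hsymm, hlt⟩ k hk t hx⟩
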